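/- **Setting.** Let $d\in\{2,3\}$ and $k\ge 1$. Let $\mathbf F$ be a bi-Lipschitz parametrization from $[0,1]^d$ into $\mathbb R^d$ such that $\Omega_0:=\mathbf F((0,1)^d)$ is open. Let $\Omega=\Omega_0\setminus\overline{\Omega}_1$ be a trimmed domain whose boundary $\Gamma=\partial\Omega$ is Lipschitz-regular. Fix a volume-ratio threshold $\theta\in(0,1]$, a shape-regularity constant $\sigma>0$ and a neighbor constant $c>0$. **Meshes.** Consider any $k$-open knot vectors $\Xi_1,\dots,\Xi_d$ on $[0,1]$ (the first and last $k+1$ knots are $0$ and $1$ respectively, internal knots lie in $(0,1)$ and have multiplicity at most $k$). Let $\hat{\mathcal M}_{0,h}$ be the Cartesian mesh of $(0,1)^d$ made of the open boxes $Q$ between consecutive breakpoints. Suppose that every edge of every $Q$ has length at least $\sigma\operatorname{diam}(Q)$, and that $\mathbf F|_{\overline Q}$ and $\mathbf F^{-1}|_{\overline{\mathbf F(Q)}}$ are $C^\infty$ for every $Q$. The active mesh is $\mathcal M_h=\{K=\mathbf F(Q): Q\in\hat{\mathcal M}_{0,h},\ Q\cap\mathbf F^{-1}(\Omega)\neq\emptyset\}$.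 For $K\in\mathcal M_h$ put $h_K=\operatorname{diam}K$ and $\Gamma_K=\Gamma\cap K$, and let $\mathsf h$ be the function equal to $h_K$ on each $K$. Let $\hat Q_h$ be the span of the tensor-product B-splines of degree $k$ in each variable associated with $\Xi_1,\dots,\Xi_d$, and let $Q_h$ be the space of the restrictions to $\Omega$ of the functions $q$ on $\Omega_0$ with $q\circ\mathbf F\in\hat Q_h$. On $\Gamma_K$, functions of $Q_h$ are understood through their trace from $K$, that is, through these functions $q$. **Good and bad elements.** $K\in\mathcal M_h$ is good if $|K\cap\Omega|\ge\theta|K|$ and bad otherwise. A good neighbor of $K$ is a good element $K'\in\mathcal M_h$, $K'\ne K$, with $\operatorname{dist}(K,K')\le c\,h_K$ and $K'\subset\bigcup\{\overline L: L\in\mathcal M_h,\ \Gamma_L=\emptyset\}$. Assume that every bad element has a good neighbor, and choose one, denoted $K'$, for every bad element $K$; for good $K$ put $K'=K$. **Operator.** For $q_h\in Q_h$ define $R^p_h(q_h)$ element by element. If $K$ is good, $R^p_h(q_h)|_K=q_h|_K$. If $K$ is bad, $R^p_h(q_h)|_K$ is the restriction to $K$ of the polynomial $\Pi_{K'}(q_h)$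 (extended canonically from $K'$ to $K$), where $\Pi_{K'}$ is the $L^2(K')$-orthogonal projection onto the space $\mathbb Q_k$ of polynomials of degree at most $k$ in each variable. **Proposition.** There exist constants $C_1,C_2>0$, depending only on $d,k,\mathbf F,\Omega,\theta,\sigma,c$ (hence independent of the mesh, of its size, of the way it is cut by $\Gamma$ and of the choice of the good neighbors), such that for all such meshes, all $K\in\mathcal M_h$ and all $q_h\in Q_h$ $$\|\mathsf h^{1/2}R^p_h(q_h)\|_{L^2(\Gamma_K)}\le C_1\|q_h\|_{L^2(K'\cap\Omega)},\qquad \|R^p_h(q_h)\|_{L^2(K\cap\Omega)}\le C_2\|q_h\|_{L^2(K'\cap\Omega)}.$$ -/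

import Mathlib

open MeasureTheory Set
open scoped ContDiff

noncomputable section

namespace TrimmedIGA

/-- The space `ℝ^d` with its Euclidean norm. -/
abbrev E (d : ℕ) := EuclideanSpace ℝ (Fin d)

/-! ### Univariate and tensor product B-splines -/

/-- A `k`-open knot vector on `[0,1]` with `n` B-splines of degree `k`. Its knots are
`knot 0 ≤ ... ≤ knot (n + k)`; they start with exactly `k + 1` zeros, end with exactly `k + 1` ones,
and every internal knot has multiplicity at most `k`. (The sequence is continued by the value `1`
after the index `n + k`; these further entries play no role.) -/
structure OpenKnotVector (k : ℕ) where
  /-- number of B-splines -/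
  n : ℕ
  /-- the knots, numbered from `0` -/
  knot : ℕ → ℝ
  lt_n : k < n
  mono : Monotone knot
  knot_left : ∀ i, i ≤ k → knot i = 0
  knot_right : ∀ i, n ≤ i → knot i = 1
  knot_interior : ∀ i, k < i → i < n → 0 < knot i ∧ knot i < 1
  mult_le : ∀ i, k < i → i + k < n → knot i < knot (i + k)

/-- The Cox-de Boor recursion: `bspline ξ p i` is the `i`-th B-spline of degree `p` for the knots `ξ`
(with the usual convention `0 / 0 = 0`). With half-open intervals in degree `0` the last B-spline
vanishes at the right end point `1`; only values in `(0,1)` are used below. -/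
def bspline (ξ : ℕ → ℝ) : ℕ → ℕ → ℝ → ℝ
  | 0, i, x => (Ico (ξ i) (ξ (i + 1))).indicator (fun _ => (1 : ℝ)) x
  | p + 1, i, x =>
      (x - ξ i) / (ξ (i + p + 1) - ξ i) * bspline ξ p i x +
      (ξ (i + p + 2) - x) / (ξ (i + p + 2) - ξ (i + 1)) * bspline ξ p (i + 1) x

/-- The tensor product spline space of degree `k` in each variable: the span of the products of
univariate B-splines. -/
def splineSpace {d k : ℕ} (T : Fin d → OpenKnotVector k) : Submodule ℝ (E d → ℝ) :=
  Submodule.span ℝ {B | ∃ i : Fin d → ℕ, (∀ l, i l < (T l).n) ∧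
    B = fun x => ∏ l, bspline (T l).knot k (i l) (x l)}

/-! ### Meshes -/

/-- The open parametric domain `(0,1)^d`. -/
def openCube (d : ℕ) : Set (E d) := {x | ∀ l, x l ∈ Ioo (0 : ℝ) 1}

/-- The closed parametric domain `[0,1]^d`. -/
def closedCube (d : ℕ) : Set (E d) := {x | ∀ l, x l ∈ Icc (0 : ℝ) 1}

/-- The multi-index `j` selects in every direction a nonempty interval between two consecutive
knots, that is, an interval between two consecutive breakpoints. -/
def IsSpan {d k : ℕ} (T : Fin d → OpenKnotVector k) (j : Fin d → ℕ) : Prop :=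
  ∀ l, (T l).knot (j l) < (T l).knot (j l + 1)

/-- The open box between consecutive knots with multi-index `j`. -/
def box {d k : ℕ} (T : Fin d → OpenKnotVector k) (j : Fin d → ℕ) : Set (E d) :=
  {x | ∀ l, x l ∈ Ioo ((T l).knot (j l)) ((T l).knot (j l + 1))}

/-- The parametric Bezier mesh. -/
def paramMesh {d k : ℕ} (T : Fin d → OpenKnotVector k) : Set (Set (E d)) :=
  {Q | ∃ j, IsSpan T j ∧ Q = box T j}

/-- Shape regularity with constant `σ`: the smallest edge of every parametric element is at least
`σ` times its diameter. -/
def ShapeRegular {d k : ℕ} (σ : ℝ) (T : Fin d → OpenKnotVector k) : Prop :=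
  ∀ j, IsSpan T j → ∀ l,
    σ * Metric.diam (box T j) ≤ (T l).knot (j l + 1) - (T l).knot (j l)

/-- `F` is bi-Lipschitz on the (closed) cube, and the physical untrimmed domain
`Ω₀ = F((0,1)^d)` is open. -/
structure IsParametrization {d : ℕ} (F : E d → E d) : Prop where
  lipschitz : ∃ L : ℝ, ∀ x ∈ closedCube d, ∀ y ∈ closedCube d, dist (F x) (F y) ≤ L * dist x y
  antilipschitz : ∃ L : ℝ, ∀ x ∈ closedCube d, ∀ y ∈ closedCube d,
    dist x y ≤ L * dist (F x) (F y)
  isOpen_image : IsOpen (F '' openCube d)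

/-- `F` is smooth on the closure of every element of the parametric mesh and its inverse is smooth on
the closure of every physical element. -/
def SmoothOnElements {d k : ℕ} (F : E d → E d) (T : Fin d → OpenKnotVector k) : Prop :=
  ∀ Q ∈ paramMesh T, ContDiffOn ℝ ∞ F (closure Q) ∧
    ContDiffOn ℝ ∞ (Function.invFunOn F (closedCube d)) (closure (F '' Q))

/-- The trimmed domain `Ω = Ω₀ \ closure Ω₁` with `Ω₀ = F((0,1)^d)`. -/
def trimmedDomain {d : ℕ} (F : E d → E d) (Ω₁ : Set (E d)) : Set (E d) :=
  (F '' openCube d) \ closure Ω₁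

/-- Lipschitz regular boundary: near each boundary point, `D` is the region strictly above the graph
of a Lipschitz function of the coordinates orthogonal to some unit vector `e`. -/
def HasLipschitzBoundary {d : ℕ} (D : Set (E d)) : Prop :=
  ∀ x ∈ frontier D, ∃ r > (0 : ℝ), ∃ e : E d, ‖e‖ = 1 ∧
    ∃ (L : NNReal) (φ : E d → ℝ), LipschitzWith L φ ∧
      ∀ y ∈ Metric.ball x r, (y ∈ D ↔ φ (y - inner ℝ e y • e) < inner ℝ e y)

/-- The active physical Bezier mesh: the images under `F` of the parametric elements that meet
`F⁻¹(Ω)`. -/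
def activeMesh {d k : ℕ} (F : E d → E d) (Ω : Set (E d)) (T : Fin d → OpenKnotVector k) :
    Set (Set (E d)) :=
  {K | ∃ Q ∈ paramMesh T, (Q ∩ (openCube d ∩ F ⁻¹' Ω)).Nonempty ∧ K = F '' Q}

/-- The (pressure) functions on `Ω₀` whose pullback by `F` is a spline. The discrete pressures on
`Ω` are their restrictions to `Ω`. -/
def pressureSpace {d k : ℕ} (F : E d → E d) (T : Fin d → OpenKnotVector k) : Set (E d → ℝ) :=
  {q | ∃ s ∈ splineSpace T, ∀ x ∈ openCube d, q (F x) = s x}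

/-! ### Good and bad elements

Below, `M` is the active mesh and `Ω` the physical domain. -/

/-- The part `Γ_K` of the boundary of `Ω` in the (open) element `K`. -/
def boundaryPart {d : ℕ} (Ω K : Set (E d)) : Set (E d) := frontier Ω ∩ K

/-- The cut elements. -/
def cutElements {d : ℕ} (M : Set (Set (E d))) (Ω : Set (E d)) : Set (Set (E d)) :=
  {K ∈ M | (boundaryPart Ω K).Nonempty}

/-- The good elements, for the volume-ratio threshold `θ`. -/
def goodElements {d : ℕ} (M : Set (Set (E d))) (Ω : Set (E d)) (θ : ℝ) : Set (Set (E d)) :=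
  {K ∈ M | θ ≤ volume.real (K ∩ Ω) / volume.real K}

/-- The bad elements. -/
def badElements {d : ℕ} (M : Set (Set (E d))) (Ω : Set (E d)) (θ : ℝ) : Set (Set (E d)) :=
  M \ goodElements M Ω θ

/-- The distance between two sets. -/
def setDist {d : ℕ} (A B : Set (E d)) : ℝ := ⨅ p : A × B, dist (p.1 : E d) (p.2 : E d)

/-- The neighbors of `K`: the other active elements at distance at most `c * h_K`. -/
def neighbors {d : ℕ} (M : Set (Set (E d))) (c : ℝ) (K : Set (E d)) : Set (Set (E d)) :=
  {K' ∈ M | setDist K K' ≤ c * Metric.diam K} \ {K}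

/-- The closed region covered by the uncut active elements. -/
def interiorRegion {d : ℕ} (M : Set (Set (E d))) (Ω : Set (E d)) : Set (E d) :=
  ⋃ K ∈ M \ cutElements M Ω, closure K

/-- `K'` is a good neighbor of `K`. -/
def IsGoodNeighbor {d : ℕ} (M : Set (Set (E d))) (Ω : Set (E d)) (θ c : ℝ)
    (K K' : Set (E d)) : Prop :=
  K' ∈ neighbors M c K ∩ goodElements M Ω θ ∧ K' ⊆ interiorRegion M Ω

open scoped Classical in
/-- The element `K'` attached to `K`: the chosen good neighbor `nb K` if `K` is bad, and `K`
itself if `K` is good. -/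
def attached {d : ℕ} (M : Set (Set (E d))) (Ω : Set (E d)) (θ : ℝ)
    (nb : Set (E d) → Set (E d)) (K : Set (E d)) : Set (E d) :=
  if K ∈ badElements M Ω θ then nb K else K

/-! ### The stabilization operator -/

/-- The polynomial function on `ℝ^d` given by `P`. -/
def polyFun {d : ℕ} (P : MvPolynomial (Fin d) ℝ) (x : E d) : ℝ :=
  MvPolynomial.eval (fun l => x l) P

/-- `P` is the `L²(S)`-orthogonal projection of `u` on the polynomials of degree at most `k` in each
variable. -/
def IsL2Proj {d : ℕ} (k : ℕ) (S : Set (E d)) (u : E d → ℝ) (P : MvPolynomial (Fin d) ℝ) : Prop :=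
  P ∈ MvPolynomial.restrictDegree (Fin d) ℝ k ∧
    ∀ r ∈ MvPolynomial.restrictDegree (Fin d) ℝ k, ∫ x in S, (u x - polyFun P x) * polyFun r x = 0

/-- The `L²(S)`-orthogonal projection, as a polynomial on all of `ℝ^d`; so its canonical polynomial
extension from `S` to any larger set is given by the same `P`. It exists and is unique for nonempty
bounded open `S` and `u ∈ L²(S)`, see `existsUnique_isL2Proj`. -/
def l2Proj {d : ℕ} (k : ℕ) (S : Set (E d)) (u : E d → ℝ) : MvPolynomial (Fin d) ℝ :=
  Classical.epsilon (IsL2Proj k S u)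

theorem continuous_polyFun {d : ℕ} (P : MvPolynomial (Fin d) ℝ) : Continuous (polyFun P) := by
  unfold polyFun
  exact (MvPolynomial.continuous_eval P).comp (by fun_prop)

theorem memLp_polyFun {d : ℕ} (P : MvPolynomial (Fin d) ℝ) {S : Set (E d)}
    (hb : Bornology.IsBounded S) : MemLp (polyFun P) 2 (volume.restrict S) := by
  have hc : IsCompact (closure S) := hb.isCompact_closure
  obtain ⟨C, hC⟩ := hc.exists_bound_of_continuousOn (continuous_polyFun P).continuousOn
  have : IsFiniteMeasure (volume.restrict (closure S)) :=
    ⟨by rw [Measure.restrict_apply_univ]; exact hc.measure_lt_top⟩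
  have h : MemLp (polyFun P) 2 (volume.restrict (closure S)) := by
    refine MemLp.of_bound (continuous_polyFun P).aestronglyMeasurable C ?_
    filter_upwards [ae_restrict_mem isClosed_closure.measurableSet] with x hx using hC x hx
  exact h.mono_measure (Measure.restrict_mono subset_closure le_rfl)

theorem existsUnique_isL2Proj {d : ℕ} (k : ℕ) {S : Set (E d)} (ho : IsOpen S) (hne : S.Nonempty)
    (hb : Bornology.IsBounded S) {u : E d → ℝ} (hu : MemLp u 2 (volume.restrict S)) :
    ∃! P, IsL2Proj k S u P := by
  classical
  let V := MvPolynomial.restrictDegree (Fin d) ℝ k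
  have add_fun (p r : MvPolynomial (Fin d) ℝ) (x : E d) :
      polyFun (p + r) x = polyFun p x + polyFun r x := by simp [polyFun]
  have smul_fun (a : ℝ) (p : MvPolynomial (Fin d) ℝ) (x : E d) :
      polyFun (a • p) x = a * polyFun p x := by simp [polyFun, MvPolynomial.smul_eval]
  have int (p r : MvPolynomial (Fin d) ℝ) :
      Integrable (fun x => polyFun p x * polyFun r x) (volume.restrict S) :=
    (memLp_polyFun p hb).integrable_mul (memLp_polyFun r hb)
  have intu (r : MvPolynomial (Fin d) ℝ) :
      Integrable (fun x => u x * polyFun r x) (volume.restrict S) :=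
    hu.integrable_mul (memLp_polyFun r hb)
  let B : V →ₗ[ℝ] Module.Dual ℝ V := LinearMap.mk₂ ℝ
    (fun p r => ∫ x in S, polyFun (p : MvPolynomial (Fin d) ℝ) x * polyFun (r : MvPolynomial (Fin d) ℝ) x)
    (fun p p' r => by
      simp only [Submodule.coe_add, add_fun, add_mul]
      exact integral_add (int _ _) (int _ _))
    (fun a p r => by
      simp only [Submodule.coe_smul, smul_fun, mul_assoc, smul_eq_mul]
      exact integral_const_mul _ _)
    (fun p r r' => by
      simp only [Submodule.coe_add, add_fun, mul_add]
      exact integral_add (int _ _) (int _ _))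
    (fun a p r => by
      simp only [Submodule.coe_smul, smul_fun, mul_left_comm _ a, smul_eq_mul]
      exact integral_const_mul _ _)
  have hB (p r : V) : B p r = ∫ x in S, polyFun (p : MvPolynomial (Fin d) ℝ) x *
      polyFun (r : MvPolynomial (Fin d) ℝ) x := rfl
  have hinj : Function.Injective B := by
    rw [injective_iff_map_eq_zero]
    intro p hp
    have h0 : ∫ x in S, polyFun (p : MvPolynomial (Fin d) ℝ) x *
        polyFun (p : MvPolynomial (Fin d) ℝ) x = 0 := by
      rw [← hB, hp]; rfl
    rw [integral_eq_zero_iff_of_nonneg (fun x => mul_self_nonneg _) (int _ _)] at h0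
    have hae : polyFun (p : MvPolynomial (Fin d) ℝ) =ᵐ[volume.restrict S] fun _ => 0 := by
      filter_upwards [h0] with x hx
      simpa using hx
    have hzero : EqOn (polyFun (p : MvPolynomial (Fin d) ℝ)) (fun _ => 0) S :=
      Measure.eqOn_open_of_ae_eq hae ho (continuous_polyFun _).continuousOn
        continuousOn_const
    obtain ⟨x₀, hx₀⟩ := hne
    have hnhds : (WithLp.toLp 2 : (Fin d → ℝ) → E d) ⁻¹' S ∈ nhds (fun l => x₀ l) :=
      (PiLp.continuous_toLp 2 _).continuousAt.preimage_mem_nhds (ho.mem_nhds hx₀)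
    obtain ⟨ε, hε, hball⟩ := Metric.mem_nhds_iff.1 hnhds
    apply Subtype.ext
    refine MvPolynomial.funext_set (fun l => Metric.ball (x₀ l) ε) (fun l => ?_) (fun y hy => ?_)
    · rw [Real.ball_eq_Ioo]
      exact Ioo_infinite (by linarith)
    · have hy' : y ∈ Metric.ball (fun l => x₀ l) ε := by
        rw [ball_pi _ hε]; exact hy
      have := hzero (hball hy')
      simpa [polyFun] using this
  have hsurj : Function.Surjective B :=
    (LinearMap.injective_iff_surjective_of_finrank_eq_finrank
      Subspace.dual_finrank_eq.symm).1 hinj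
  let f : Module.Dual ℝ V :=
    { toFun := fun r => ∫ x in S, u x * polyFun (r : MvPolynomial (Fin d) ℝ) x
      map_add' := fun r r' => by
        simp only [Submodule.coe_add, add_fun, mul_add]
        exact integral_add (intu _) (intu _)
      map_smul' := fun a r => by
        simp only [Submodule.coe_smul, smul_fun, mul_left_comm _ a, smul_eq_mul, RingHom.id_apply]
        exact integral_const_mul _ _ }
  have hf (r : V) : f r = ∫ x in S, u x * polyFun (r : MvPolynomial (Fin d) ℝ) x := rfl
  have key (p : V) : IsL2Proj k S u p ↔ B p = f := by
    have hsub (r : V) : ∫ x in S, (u x - polyFun (p : MvPolynomial (Fin d) ℝ) x) *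
        polyFun (r : MvPolynomial (Fin d) ℝ) x = f r - B p r := by
      rw [hf, hB, ← integral_sub (intu _) (int _ _)]
      simp only [sub_mul]
    constructor
    · intro h
      ext1 r
      have := hsub r
      rw [h.2 r r.2] at this
      linarith
    · intro h
      refine ⟨p.2, fun r hr => ?_⟩
      rw [hsub ⟨r, hr⟩, h, sub_self]
  obtain ⟨p, hp⟩ := hsurj f
  refine ⟨p, (key p).2 hp, fun P hP => ?_⟩
  have := (key ⟨P, hP.1⟩).1 hP
  exact congrArg Subtype.val (hinj (this.trans hp.symm))

open scoped Classical in
/-- The local operator `R^p_K`: the identity on good elements, and on bad elements the extension of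
the projection of `q` on the good neighbor. -/
def localStab {d : ℕ} (k : ℕ) (M : Set (Set (E d))) (Ω : Set (E d)) (θ : ℝ)
    (nb : Set (E d) → Set (E d)) (K : Set (E d)) (q : E d → ℝ) : E d → ℝ :=
  if K ∈ badElements M Ω θ then polyFun (l2Proj k (nb K) q) else q

/-- The element of the mesh `M` that contains `x` (the elements are pairwise disjoint); empty if there
is none. -/
def cellAt {d : ℕ} (M : Set (Set (E d))) (x : E d) : Set (E d) := ⋃₀ {K ∈ M | x ∈ K}

theorem cellAt_eq {d k : ℕ} {F : E d → E d} (hF : IsParametrization F) {Ω : Set (E d)}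
    {T : Fin d → OpenKnotVector k} {K : Set (E d)} (hK : K ∈ activeMesh F Ω T) {x : E d}
    (hx : x ∈ K) : cellAt (activeMesh F Ω T) x = K := by
  have hsub (j : Fin d → ℕ) : box T j ⊆ closedCube d := by
    intro y hy l
    refine ⟨?_, ?_⟩
    · rw [← (T l).knot_left 0 (Nat.zero_le _)]
      exact ((T l).mono (Nat.zero_le _)).trans (hy l).1.le
    · rw [← (T l).knot_right (max (j l + 1) (T l).n) (le_max_right _ _)]
      exact (hy l).2.le.trans ((T l).mono (le_max_left _ _))
  have huniq : ∀ K' ∈ activeMesh F Ω T, x ∈ K' → K' = K := by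
    obtain ⟨_, ⟨j, _, rfl⟩, _, rfl⟩ := hK
    rintro _ ⟨_, ⟨j', _, rfl⟩, _, rfl⟩ hx'
    obtain ⟨y, hy, rfl⟩ := hx
    obtain ⟨z, hz, hzy⟩ := hx'
    obtain ⟨L, hL⟩ := hF.antilipschitz
    have h := hL z (hsub _ hz) y (hsub _ hy)
    rw [hzy, dist_self, mul_zero] at h
    have hzy' : z = y := dist_le_zero.1 h
    subst hzy'
    have hj : j' = j := by
      funext l
      have h1 := (T l).mono.reflect_lt ((hy l).1.trans (hz l).2)
      have h2 := (T l).mono.reflect_lt ((hz l).1.trans (hy l).2)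
      omega
    rw [hj]
  apply Subset.antisymm
  · exact sUnion_subset fun K' hK' => (huniq K' hK'.1 hK'.2).le
  · exact subset_sUnion_of_mem ⟨hK, hx⟩

/-- The piecewise constant mesh-size function, equal to `h_K = diam K` on every element `K`. -/
def meshSize {d : ℕ} (M : Set (Set (E d))) (x : E d) : ℝ := Metric.diam (cellAt M x)

/-- The stabilization operator `R^p_h`, equal to `R^p_K` on every element `K`. -/
def stab {d : ℕ} (k : ℕ) (M : Set (Set (E d))) (Ω : Set (E d)) (θ : ℝ)
    (nb : Set (E d) → Set (E d)) (q : E d → ℝ) : E d → ℝ :=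
  fun x => localStab k M Ω θ nb (cellAt M x) q x

end TrimmedIGA

end

open TrimmedIGA

namespace TrimmedIGA

/-! ### Polynomials of degree at most `k` in each variable -/

/-! Both estimates follow from one pointwise inverse inequality, `exists_bound_localStab`: for `x ∈
K`, the value `R q(x)` satisfies `|R q(x)|² h_K^d ≤ C ‖q‖²` with the norm over `K' ∩ Ω`. Integrating
over `K ∩ Ω`, of volume at most a constant times `h_K^d`, gives the volume estimate. Integrating
over `Γ_K`, of surface measure at most a constant times `h_K^(d-1)` because `Γ` is locally a
Lipschitz graph (`exists_measure_frontier_le`), gives the trace estimate, the missing power being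
supplied by the weight `h_K`.

The inverse inequality must hold on sets of arbitrary shape, so it rests on a Remez-type property
(`exists_sublevel_ball`): a polynomial is smaller than `ε |P x|` only on a small fraction of a ball
containing `x`. Any subset of the ball that fills a fixed fraction of it therefore has a substantial
part where `|P| ≥ ε |P x|`, and Chebyshev's inequality concludes.

On a good element this is applied in the parametric domain, where `q ∘ F` is a polynomial, to `Q ∩
F⁻¹(Ω)`. On a bad one it is applied in the physical domain to the projected polynomial and the set
`K'`, followed by the contraction property of the projection. The required comparability of `K` and
`K'` holds because shape regularity of a tensor-product mesh forces quasi-uniformity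
(`ShapeRegular.sq_mul_diam_le`). Finally `K' ⊆ Ω` (`subset_of_subset_interiorRegion`). -/

/-- Fubini and induction: for almost every value of the last variables the leading coefficient in
the first one does not vanish, and the slice is then a finite set of roots. -/
theorem volume_zeros_mvPolynomial (n : ℕ) (f : MvPolynomial (Fin n) ℝ) (hf : f ≠ 0) :
    volume {x : Fin n → ℝ | MvPolynomial.eval x f = 0} = 0 := by
  induction n with
  | zero =>
    have : {x : Fin 0 → ℝ | MvPolynomial.eval x f = 0} = ∅ := by
      refine eq_empty_iff_forall_notMem.2 fun x (h : _ = _) => hf (MvPolynomial.funext fun y => ?_)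
      rw [Subsingleton.elim y x, h, map_zero]
    rw [this, measure_empty]
  | succ n ih =>
    have hp : MvPolynomial.finSuccEquiv ℝ n f ≠ 0 := by
      simpa using hf
    have hlead := ih _ (Polynomial.leadingCoeff_ne_zero.2 hp)
    set S := {x : Fin (n + 1) → ℝ | MvPolynomial.eval x f = 0} with hS
    have hSm : MeasurableSet S :=
      (isClosed_eq (MvPolynomial.continuous_eval f) continuous_const).measurableSet
    have hmp := (volume_preserving_piFinSuccAbove (fun _ : Fin (n + 1) => ℝ) 0).symm
    rw [← hmp.measure_preimage hSm.nullMeasurableSet, Measure.volume_eq_prod,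
      Measure.prod_apply_symm (hmp.measurable hSm)]
    refine (lintegral_congr_ae (g := fun _ => 0) ?_).trans lintegral_zero
    filter_upwards [compl_mem_ae_iff.2 hlead] with s hs
    have hq : Polynomial.map (MvPolynomial.eval s) (MvPolynomial.finSuccEquiv ℝ n f) ≠ 0 := by
      intro h0
      apply hs
      have := congrArg (fun p => p.coeff (MvPolynomial.finSuccEquiv ℝ n f).natDegree) h0
      simpa [Polynomial.coeff_map] using this
    refine (((Polynomial.map (MvPolynomial.eval s)
      (MvPolynomial.finSuccEquiv ℝ n f)).roots.toFinset.finite_toSet).subset ?_).measure_zero _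
    intro y hy
    have hy' : MvPolynomial.eval (Fin.cons y s : Fin (n + 1) → ℝ) f = 0 := by
      simpa [hS, Fin.consEquiv] using hy
    rw [MvPolynomial.eval_eq_eval_mv_eval'] at hy'
    simpa [hq] using hy'

theorem volume_zeros_polyFun {d : ℕ} {P : MvPolynomial (Fin d) ℝ} (hP : P ≠ 0) :
    volume {x : E d | polyFun P x = 0} = 0 := by
  have hm : MeasurableSet {x : Fin d → ℝ | MvPolynomial.eval x P = 0} :=
    (isClosed_eq (MvPolynomial.continuous_eval P) continuous_const).measurableSet
  rw [← volume_zeros_mvPolynomial d P hP,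
    ← (PiLp.volume_preserving_ofLp (Fin d)).measure_preimage hm.nullMeasurableSet]
  rfl

theorem exists_polyFun_eq_prod {d k : ℕ} (p : Fin d → Polynomial ℝ)
    (hp : ∀ l, (p l).natDegree ≤ k) :
    ∃ P ∈ MvPolynomial.restrictDegree (Fin d) ℝ k, ∀ x : E d,
      polyFun P x = ∏ l, (p l).eval (x l) := by
  classical
  refine ⟨∏ l, Polynomial.aeval (MvPolynomial.X l) (p l), ?_, fun x => ?_⟩
  · have key (i l : Fin d) : MvPolynomial.degreeOf i
        (Polynomial.aeval (MvPolynomial.X l : MvPolynomial (Fin d) ℝ) (p l)) ≤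
        if i = l then k else 0 := by
      rw [Polynomial.aeval_eq_sum_range]
      refine (MvPolynomial.degreeOf_sum_le _ _ _).trans (Finset.sup_le fun m hm => ?_)
      rw [MvPolynomial.smul_eq_C_mul]
      refine (MvPolynomial.degreeOf_C_mul_le _ _ _).trans ?_
      refine (MvPolynomial.degreeOf_pow_le _ _ _).trans ?_
      rw [MvPolynomial.degreeOf_X]
      have := hp l
      have := Finset.mem_range.1 hm
      split_ifs <;> simp; omega
    rw [MvPolynomial.mem_restrictDegree_iff_sup]
    intro i
    rw [← MvPolynomial.degreeOf_def]
    refine (MvPolynomial.degreeOf_prod_le i _ _).trans ?_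
    refine (Finset.sum_le_sum fun l _ => key i l).trans ?_
    simp
  · simp only [polyFun, map_prod]
    refine Finset.prod_congr rfl fun l _ => ?_
    rw [Polynomial.aeval_eq_sum_range, Polynomial.eval_eq_sum_range]
    simp [MvPolynomial.smul_eval]

theorem polyFun_eq_sum {d : ℕ} (P : MvPolynomial (Fin d) ℝ) (x : E d) :
    polyFun P x = ∑ m ∈ P.support, P.coeff m * ∏ l, x l ^ m l := by
  rw [polyFun, MvPolynomial.eval_eq']

/-- The functions given by polynomials of degree at most `k` in each variable. -/
def polySpace (d k : ℕ) : Submodule ℝ (E d → ℝ) where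
  carrier := {u | ∃ P ∈ MvPolynomial.restrictDegree (Fin d) ℝ k, polyFun P = u}
  add_mem' := by
    rintro _ _ ⟨P, hP, rfl⟩ ⟨R, hR, rfl⟩
    exact ⟨P + R, add_mem hP hR, by ext x; simp [polyFun]⟩
  zero_mem' := ⟨0, zero_mem _, by ext x; simp [polyFun]⟩
  smul_mem' := by
    rintro a _ ⟨P, hP, rfl⟩
    exact ⟨a • P, Submodule.smul_mem _ a hP, by ext x; simp [polyFun, MvPolynomial.smul_eval]⟩

/-- Translations and homotheties act on each coordinate separately, so a monomial becomes a product
of univariate polynomials of the same degrees; a general linear map would not preserve the degree in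
each variable. -/
theorem exists_polyFun_comp_affine {d k : ℕ} {P : MvPolynomial (Fin d) ℝ}
    (hP : P ∈ MvPolynomial.restrictDegree (Fin d) ℝ k) (a : E d) (r : ℝ) :
    ∃ R ∈ MvPolynomial.restrictDegree (Fin d) ℝ k, ∀ x, polyFun R x = polyFun P (a + r • x) := by
  suffices h : (fun x => polyFun P (a + r • x)) ∈ polySpace d k by
    obtain ⟨R, hR, h⟩ := h
    exact ⟨R, hR, fun x => congrFun h x⟩
  have : (fun x => polyFun P (a + r • x)) =
      ∑ m ∈ P.support, P.coeff m • fun x : E d => ∏ l, (a l + r * x l) ^ m l := by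
    ext x
    simp [polyFun_eq_sum]
  rw [this]
  refine sum_mem fun m hm => Submodule.smul_mem _ _ ?_
  obtain ⟨R, hR, h⟩ := exists_polyFun_eq_prod (k := k)
    (fun l : Fin d => (Polynomial.C (a l) + Polynomial.C r * Polynomial.X) ^ m l) (fun l => by
      refine Polynomial.natDegree_pow_le.trans ?_
      have h1 : (Polynomial.C (a l) + Polynomial.C r * Polynomial.X).natDegree ≤ 1 := by
        compute_degree
      have h2 := (MvPolynomial.mem_restrictDegree _ P k).1 hP m hm l
      nlinarith)
  exact ⟨R, hR, by ext x; simp [h]⟩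

/-! ### Sublevel sets of polynomials on balls -/

-- Compactness of the unit sphere of coefficient vectors makes uniform the fact that a nonzero
-- polynomial has a null zero set; homogeneity then removes the normalization.
open Topology in
theorem exists_sublevel_unitBall (d k : ℕ) {δ : ENNReal} (hδ : δ ≠ 0) :
    ∃ ε > (0 : ℝ), ∀ P ∈ MvPolynomial.restrictDegree (Fin d) ℝ k,
      ∀ x ∈ Metric.closedBall (0 : E d) 1,
        volume {y ∈ Metric.closedBall (0 : E d) 1 | |polyFun P y| < ε * |polyFun P x|} ≤ δ := by
  let V := MvPolynomial.restrictDegree (Fin d) ℝ k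
  let b := Module.finBasis ℝ V
  let n := Module.finrank ℝ V
  let u : (Fin n → ℝ) → E d → ℝ := fun c y =>
    polyFun ((b.equivFun.symm c : V) : MvPolynomial (Fin d) ℝ) y
  have hu (c y) : u c y = ∑ i, c i * polyFun ((b i : V) : MvPolynomial (Fin d) ℝ) y := by
    simp only [u, polyFun, Module.Basis.equivFun_symm_apply, Submodule.coe_sum,
      Submodule.coe_smul, map_sum, MvPolynomial.smul_eval]
    rfl
  have hcont : Continuous fun z : (Fin n → ℝ) × E d => u z.1 z.2 := by
    simp only [hu]
    exact continuous_finsetSum _ fun i _ =>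
      ((continuous_apply i).comp continuous_fst).mul ((continuous_polyFun _).comp continuous_snd)
  have hcont' (c) : Continuous (u c) := continuous_polyFun _
  set B := Metric.closedBall (0 : E d) 1 with hB
  have hBc : IsCompact B := isCompact_closedBall _ _
  set S := Metric.sphere (0 : Fin n → ℝ) 1 with hS
  have hSc : IsCompact S := isCompact_sphere _ _
  obtain ⟨M, hM⟩ := (hSc.prod hBc).exists_bound_of_continuousOn hcont.continuousOn
  have hloc : ∃ η > (0 : ℝ), ∀ c ∈ S, volume {y ∈ B | |u c y| < η} ≤ δ := by
    refine hSc.induction_on (p := fun s => ∃ η > (0 : ℝ), ∀ c ∈ s, volume {y ∈ B | |u c y| < η} ≤ δ)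
      ⟨1, one_pos, by simp⟩ ?_ ?_ ?_
    · rintro s t hst ⟨η, hη, h⟩
      exact ⟨η, hη, fun c hc => h c (hst hc)⟩
    · rintro s t ⟨η, hη, h⟩ ⟨η', hη', h'⟩
      refine ⟨min η η', lt_min hη hη', fun c hc => ?_⟩
      rcases hc with hc | hc
      · refine le_trans (measure_mono fun y hy => ?_) (h c hc)
        exact ⟨hy.1, hy.2.trans_le (min_le_left _ _)⟩
      · refine le_trans (measure_mono fun y hy => ?_) (h' c hc)
        exact ⟨hy.1, hy.2.trans_le (min_le_right _ _)⟩
    · intro c₀ hc₀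
      have hc₀' : ((b.equivFun.symm c₀ : V) : MvPolynomial (Fin d) ℝ) ≠ 0 := by
        intro h
        have h0 : c₀ = 0 := b.equivFun.symm.map_eq_zero_iff.1 (Subtype.ext h)
        simp [hS, h0] at hc₀
      -- These sets decrease to the zero set of `u c₀` in the ball, so one of them has measure at
      -- most `δ`. Half of its threshold is left as room for perturbing `c₀`.
      let A : ℕ → Set (E d) := fun m => {y ∈ B | |u c₀ y| ≤ 1 / ((m : ℝ) + 1)}
      have hAm (m) : MeasurableSet (A m) :=
        (hBc.isClosed.inter (isClosed_le (hcont' c₀).abs continuous_const)).measurableSet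
      have hAanti : Antitone A := fun m m' hmm y hy =>
        ⟨hy.1, hy.2.trans (one_div_le_one_div_of_le (by positivity) (by gcongr))⟩
      have hA0 : volume (⋂ m, A m) = 0 := by
        refine measure_mono_null (fun y hy => ?_) (volume_zeros_polyFun hc₀')
        have h1 : ∀ m : ℕ, |u c₀ y| ≤ 1 / ((m : ℝ) + 1) := fun m => (mem_iInter.1 hy m).2
        have h2 : |u c₀ y| ≤ 0 := ge_of_tendsto' tendsto_one_div_add_atTop_nhds_zero_nat h1
        exact abs_nonpos_iff.1 h2
      have hlim := tendsto_measure_iInter_atTop (μ := volume)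
        (fun m => (hAm m).nullMeasurableSet) hAanti
        ⟨0, ((measure_mono fun y hy => hy.1).trans_lt hBc.measure_lt_top).ne⟩
      rw [hA0] at hlim
      obtain ⟨m, hm⟩ := (hlim.eventually (ge_mem_nhds (pos_iff_ne_zero.2 hδ))).exists
      set η : ℝ := 1 / ((m : ℝ) + 1) / 2 with hη
      have hη0 : 0 < η := by positivity
      have hnear : ∀ᶠ c in 𝓝 c₀, ∀ y ∈ B, |u c y - u c₀ y| < η := by
        refine hBc.eventually_forall_of_forall_eventually fun y _ => ?_
        have : Continuous fun z : (Fin n → ℝ) × E d => |u z.1 z.2 - u c₀ z.2| :=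
          (hcont.sub ((hcont' c₀).comp continuous_snd)).abs
        exact this.continuousAt.eventually_lt continuousAt_const (by simpa using hη0)
      refine ⟨_, mem_nhdsWithin_of_mem_nhds hnear, η, hη0, fun c hc => ?_⟩
      refine le_trans (measure_mono fun y hy => ?_) hm
      refine ⟨hy.1, ?_⟩
      have h1 : |u c y - u c₀ y| < η := hc y hy.1
      have h2 := hy.2
      have h3 : η + η = 1 / ((m : ℝ) + 1) := by rw [hη]; ring
      rw [← h3]
      rw [abs_lt] at h1 h2
      rw [abs_le]
      constructor <;> linarith
  obtain ⟨η, hη, hloc⟩ := hloc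
  -- `M` bounds normalized polynomials on the ball, so `ε |P x|` is at most `η` times the norm of
  -- the coefficients.
  refine ⟨η / (|M| + 1), by positivity, fun P hP x hx => ?_⟩
  rcases eq_or_ne P 0 with rfl | hP0
  · simp [polyFun]
  set c := b.equivFun ⟨P, hP⟩ with hc
  have hcP (y) : u c y = polyFun P y := by
    simp only [u, hc, LinearEquiv.symm_apply_apply]
  have hc0 : c ≠ 0 := by
    intro h
    rw [hc, map_eq_zero_iff _ b.equivFun.injective] at h
    exact hP0 (congrArg Subtype.val h)
  have hcpos : 0 < ‖c‖ := norm_pos_iff.2 hc0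
  set c' := ‖c‖⁻¹ • c with hc'
  have hc'S : c' ∈ S := by
    simp [hS, hc', norm_smul, hcpos.ne']
  have hscale (y) : polyFun P y = ‖c‖ * u c' y := by
    rw [← hcP, hu, hu, Finset.mul_sum]
    refine Finset.sum_congr rfl fun i _ => ?_
    simp only [hc', Pi.smul_apply, smul_eq_mul]
    field_simp
  refine le_trans (measure_mono fun y hy => ?_) (hloc c' hc'S)
  refine ⟨hy.1, ?_⟩
  have h1 := hy.2
  rw [hscale, hscale, abs_mul, abs_mul, abs_of_pos hcpos] at h1
  have h2 : |u c' x| ≤ |M| + 1 := by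
    have := hM (c', x) ⟨hc'S, hx⟩
    rw [Real.norm_eq_abs] at this
    linarith [le_abs_self M]
  have h3 : η / (|M| + 1) * (‖c‖ * |u c' x|) ≤ ‖c‖ * η := by
    rw [div_mul_eq_mul_div, div_le_iff₀ (by positivity)]
    calc η * (‖c‖ * |u c' x|) = ‖c‖ * η * |u c' x| := by ring
      _ ≤ ‖c‖ * η * (|M| + 1) := by gcongr
  exact lt_of_mul_lt_mul_left (h1.trans_le h3) hcpos.le

open scoped Pointwise in
/-- A Remez type property: a polynomial is small compared with its values on a ball only on a small
part of the ball. -/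
theorem exists_sublevel_ball (d k : ℕ) {δ : ℝ} (hδ : 0 < δ) :
    ∃ ε > (0 : ℝ), ∀ P ∈ MvPolynomial.restrictDegree (Fin d) ℝ k, ∀ (a : E d) (r : ℝ), 0 < r →
      ∀ x ∈ Metric.closedBall a r,
        volume {y ∈ Metric.closedBall a r | |polyFun P y| < ε * |polyFun P x|} ≤
          ENNReal.ofReal (δ * r ^ d) := by
  obtain ⟨ε, hε, h⟩ := exists_sublevel_unitBall d k (δ := ENNReal.ofReal δ) (by simpa using hδ)
  refine ⟨ε, hε, fun P hP a r hr x hx => ?_⟩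
  obtain ⟨R, hR, hRP⟩ := exists_polyFun_comp_affine hP a r
  have hback (z : E d) : a + r • (r⁻¹ • (z - a)) = z := by
    rw [smul_inv_smul₀ hr.ne']; abel
  have hmem (z : E d) (hz : z ∈ Metric.closedBall a r) :
      r⁻¹ • (z - a) ∈ Metric.closedBall (0 : E d) 1 := by
    rw [mem_closedBall_iff_norm] at hz
    rw [mem_closedBall_zero_iff, norm_smul, norm_inv, Real.norm_of_nonneg hr.le,
      inv_mul_le_iff₀ hr, mul_one]
    exact hz
  have h1 := h R hR _ (hmem x hx)
  let U : Set (E d) := {y ∈ Metric.closedBall (0 : E d) 1 | |polyFun R y| <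
    ε * |polyFun R (r⁻¹ • (x - a))|}
  have hsub : {y ∈ Metric.closedBall a r | |polyFun P y| < ε * |polyFun P x|} ⊆
      (fun z => a + z) '' (r • U) := by
    intro y hy
    refine ⟨r • (r⁻¹ • (y - a)), smul_mem_smul_set ?_, hback y⟩
    refine ⟨hmem y hy.1, ?_⟩
    rw [hRP, hRP, hback, hback]
    exact hy.2
  refine (measure_mono hsub).trans ?_
  rw [image_add_left, measure_preimage_add, Measure.addHaar_smul, finrank_euclideanSpace_fin,
    abs_of_pos (pow_pos hr d), mul_comm δ, ENNReal.ofReal_mul (pow_pos hr d).le]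
  gcongr

/-! ### Splines are polynomials on every element -/

theorem exists_bspline_eq_eval {ξ : ℕ → ℝ} (hξ : Monotone ξ) (j p i : ℕ) :
    ∃ P : Polynomial ℝ, P.natDegree ≤ p ∧
      ∀ x ∈ Ioo (ξ j) (ξ (j + 1)), bspline ξ p i x = P.eval x := by
  induction p generalizing i with
  | zero =>
    -- By monotonicity of the knots, a half-open knot interval with another index is disjoint from
    -- the open interval `j`.
    rcases eq_or_ne i j with rfl | hij
    · refine ⟨1, by simp, fun x hx => ?_⟩
      have hx' : x ∈ Ico (ξ i) (ξ (i + 1)) := ⟨hx.1.le, hx.2⟩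
      rw [bspline, indicator_of_mem hx', Polynomial.eval_one]
    · refine ⟨0, by simp, fun x hx => ?_⟩
      rw [bspline, indicator_of_notMem, Polynomial.eval_zero]
      intro h
      have h1 := hξ.reflect_lt (hx.1.trans h.2)
      have h2 := hξ.reflect_lt (h.1.trans_lt hx.2)
      omega
  | succ p ih =>
    obtain ⟨P, hP, hPx⟩ := ih i
    obtain ⟨R, hR, hRx⟩ := ih (i + 1)
    refine ⟨Polynomial.C (ξ (i + p + 1) - ξ i)⁻¹ * (Polynomial.X - Polynomial.C (ξ i)) * P +
      Polynomial.C (ξ (i + p + 2) - ξ (i + 1))⁻¹ *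
        (Polynomial.C (ξ (i + p + 2)) - Polynomial.X) * R, ?_, fun x hx => ?_⟩
    · have h1 (a b : ℝ) : (Polynomial.C a * (Polynomial.X - Polynomial.C b)).natDegree ≤ 1 := by
        compute_degree
      have h2 (a b : ℝ) : (Polynomial.C a * (Polynomial.C b - Polynomial.X)).natDegree ≤ 1 := by
        compute_degree
      refine Polynomial.natDegree_add_le_of_degree_le ?_ ?_
      · exact Polynomial.natDegree_mul_le.trans (by have := h1 (ξ (i + p + 1) - ξ i)⁻¹ (ξ i); omega)
      · exact Polynomial.natDegree_mul_le.trans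
          (by have := h2 (ξ (i + p + 2) - ξ (i + 1))⁻¹ (ξ (i + p + 2)); omega)
    · rw [bspline, hPx x hx, hRx x hx]
      simp only [Polynomial.eval_add, Polynomial.eval_mul, Polynomial.eval_sub, Polynomial.eval_C,
        Polynomial.eval_X]
      ring

theorem exists_polyFun_eqOn_box {d k : ℕ} (T : Fin d → OpenKnotVector k) (j : Fin d → ℕ)
    {s : E d → ℝ} (hs : s ∈ splineSpace T) :
    ∃ P ∈ MvPolynomial.restrictDegree (Fin d) ℝ k, EqOn s (polyFun P) (box T j) := by
  induction hs using Submodule.span_induction with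
  | mem s h =>
    obtain ⟨i, _, rfl⟩ := h
    choose p hp hpx using fun l => exists_bspline_eq_eval (T l).mono (j l) k (i l)
    obtain ⟨P, hP, hPx⟩ := exists_polyFun_eq_prod p hp
    refine ⟨P, hP, fun x hx => ?_⟩
    rw [hPx]
    exact Finset.prod_congr rfl fun l _ => hpx l _ (hx l)
  | zero => exact ⟨0, zero_mem _, fun x _ => by simp [polyFun]⟩
  | add s t _ _ hs ht =>
    obtain ⟨P, hP, hPx⟩ := hs
    obtain ⟨R, hR, hRx⟩ := ht
    refine ⟨P + R, add_mem hP hR, fun x hx => ?_⟩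
    simp only [Pi.add_apply, hPx hx, hRx hx, polyFun, map_add]
  | smul a s _ hs =>
    obtain ⟨P, hP, hPx⟩ := hs
    refine ⟨a • P, Submodule.smul_mem _ a hP, fun x hx => ?_⟩
    simp only [Pi.smul_apply, hPx hx, polyFun, MvPolynomial.smul_eval, smul_eq_mul]

/-! ### The `L²` projection -/

theorem isL2Proj_l2Proj {d : ℕ} (k : ℕ) {S : Set (E d)} (ho : IsOpen S) (hne : S.Nonempty)
    (hb : Bornology.IsBounded S) {u : E d → ℝ} (hu : MemLp u 2 (volume.restrict S)) :
    IsL2Proj k S u (l2Proj k S u) :=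
  Classical.epsilon_spec (existsUnique_isL2Proj k ho hne hb hu).exists

/-- Pythagoras: the residual `u - P` is orthogonal to `P` itself, which is an admissible test
polynomial. -/
theorem IsL2Proj.eLpNorm_le {d k : ℕ} {S : Set (E d)} (hb : Bornology.IsBounded S)
    {u : E d → ℝ} (hu : MemLp u 2 (volume.restrict S)) {P : MvPolynomial (Fin d) ℝ}
    (hP : IsL2Proj k S u P) :
    eLpNorm (polyFun P) 2 (volume.restrict S) ≤ eLpNorm u 2 (volume.restrict S) := by
  have hp := memLp_polyFun P hb
  have key : ∫ x in S, polyFun P x ^ 2 ≤ ∫ x in S, u x ^ 2 := by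
    have h0 := hP.2 P hP.1
    have i1 : Integrable (fun x => (u x - polyFun P x) * polyFun P x) (volume.restrict S) :=
      (hu.sub hp).integrable_mul hp
    have i2 : Integrable (fun x => (u x - polyFun P x) ^ 2) (volume.restrict S) :=
      (hu.sub hp).integrable_sq
    have i3 := hp.integrable_sq
    have h1 : ∫ x in S, u x ^ 2 = ∫ x in S, ((u x - polyFun P x) ^ 2 +
        2 * ((u x - polyFun P x) * polyFun P x)) + polyFun P x ^ 2 := by
      congr 1 with x
      ring
    have i12 : Integrable (fun x => (u x - polyFun P x) ^ 2 +
        2 * ((u x - polyFun P x) * polyFun P x)) (volume.restrict S) := i2.add (i1.const_mul 2)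
    rw [h1, integral_add i12 i3, integral_add i2 (i1.const_mul 2), integral_const_mul, h0]
    have : 0 ≤ ∫ x in S, (u x - polyFun P x) ^ 2 := integral_nonneg fun x => sq_nonneg _
    linarith
  rw [hp.eLpNorm_eq_integral_rpow_norm (by norm_num) (by norm_num),
    hu.eLpNorm_eq_integral_rpow_norm (by norm_num) (by norm_num)]
  refine ENNReal.ofReal_le_ofReal (Real.rpow_le_rpow (integral_nonneg fun x => by positivity) ?_
    (by positivity))
  simpa using key

/-! ### The boundary measure -/

theorem euclideanHausdorffMeasure_image_le {X Y : Type*} [MetricSpace X] [MeasurableSpace X]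
    [BorelSpace X] [MetricSpace Y] [MeasurableSpace Y] [BorelSpace Y] {f : X → Y} {s : Set X}
    {L : NNReal} (hf : LipschitzOnWith L f s) (n : ℕ) :
    (μHE[n] : Measure Y) (f '' s) ≤ (L : ENNReal) ^ n * (μHE[n] : Measure X) s := by
  rw [Measure.euclideanHausdorffMeasure_def, Measure.euclideanHausdorffMeasure_def,
    Measure.smul_apply, Measure.smul_apply, mul_smul_comm]
  gcongr
  simpa using hf.hausdorffMeasure_image_le (d := n) (by positivity)

theorem norm_sub_inner_smul_le {d : ℕ} {e : E d} (he : ‖e‖ = 1) (v : E d) :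
    ‖v - inner ℝ e v • e‖ ≤ ‖v‖ := by
  refine le_of_sq_le_sq ?_ (norm_nonneg _)
  rw [norm_sub_sq_real, inner_smul_right, norm_smul, he, real_inner_comm v e, mul_one,
    Real.norm_eq_abs, sq_abs]
  nlinarith [sq_nonneg (inner ℝ v e)]

/-- Orthogonal projection onto the hyperplane orthogonal to `e` does not increase distances. Hence
the graph inside a ball is covered by the `(1 + L)`-Lipschitz image of a ball of the same radius in
that hyperplane, which is isometric to `E (d - 1)`. -/
theorem exists_measure_graph_le {d : ℕ} {e : E d} (he : ‖e‖ = 1) {L : NNReal} {φ : E d → ℝ}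
    (hφ : LipschitzWith L φ) :
    ∃ C : ℝ, 0 ≤ C ∧ ∀ (y : E d) (r : ℝ), 0 < r →
      (μHE[d - 1] : Measure (E d))
        ({w | φ (w - inner ℝ e w • e) = inner ℝ e w} ∩ Metric.closedBall y r) ≤
        ENNReal.ofReal (C * r ^ (d - 1)) := by
  have he0 : e ≠ 0 := by rintro rfl; simp at he
  have hee : inner ℝ e e = (1 : ℝ) := by rw [real_inner_self_eq_norm_sq, he, one_pow]
  have hrank : Module.finrank ℝ (ℝ ∙ e)ᗮ = d - 1 := by
    have h1 := (ℝ ∙ e).finrank_add_finrank_orthogonal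
    rw [finrank_span_singleton he0, finrank_euclideanSpace_fin] at h1
    omega
  let U : (ℝ ∙ e)ᗮ ≃ₗᵢ[ℝ] E (d - 1) :=
    ((stdOrthonormalBasis ℝ (ℝ ∙ e)ᗮ).reindex (finCongr hrank)).repr
  let p : E d → (ℝ ∙ e)ᗮ := fun w => ⟨w - inner ℝ e w • e, by
    rw [Submodule.mem_orthogonal_singleton_iff_inner_right, inner_sub_right, inner_smul_right, hee]
    ring⟩
  have hp (w w' : E d) : dist (p w) (p w') ≤ dist w w' := by
    have : ((p w : E d) - p w') = (w - w') - inner ℝ e (w - w') • e := by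
      simp only [p, inner_sub_right, sub_smul]; abel
    rw [Subtype.dist_eq, dist_eq_norm, dist_eq_norm, this]
    exact norm_sub_inner_smul_le he _
  let ψ : E (d - 1) → E d := fun z => (U.symm z : E d) + φ (U.symm z) • e
  have hψ : LipschitzWith (1 + L) ψ := by
    refine LipschitzWith.of_dist_le_mul fun z z' => ?_
    have h1 : dist (U.symm z : E d) (U.symm z') = dist z z' := by
      rw [← Subtype.dist_eq, U.symm.dist_map]
    calc dist (ψ z) (ψ z') ≤ dist (U.symm z : E d) (U.symm z') +
          dist (φ (U.symm z) • e) (φ (U.symm z') • e) := dist_add_add_le _ _ _ _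
      _ ≤ dist z z' + L * dist z z' := by
        rw [h1, dist_eq_norm (φ (U.symm z) • e), ← sub_smul, norm_smul, he, mul_one,
          ← dist_eq_norm]
        gcongr
        rw [← h1]
        exact hφ.dist_le_mul _ _
      _ = _ := by push_cast; ring
  let C := (volume (Metric.ball (0 : E (d - 1)) 1)).toReal
  refine ⟨(1 + L) ^ (d - 1) * C, by positivity, fun y r hr => ?_⟩
  have hsub : {w | φ (w - inner ℝ e w • e) = inner ℝ e w} ∩ Metric.closedBall y r ⊆
      ψ '' Metric.closedBall (U (p y)) r := by
    rintro w ⟨hw, hwy⟩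
    refine ⟨U (p w), ?_, ?_⟩
    · rw [Metric.mem_closedBall, U.dist_map]
      exact (hp w y).trans hwy
    · have hw' : φ (w - inner ℝ e w • e) = inner ℝ e w := hw
      simp only [ψ, U.symm_apply_apply, p, hw']
      abel
  refine (measure_mono hsub).trans
    ((euclideanHausdorffMeasure_image_le hψ.lipschitzOnWith (d - 1)).trans ?_)
  rw [EuclideanSpace.euclideanHausdorffMeasure_eq_volume, Measure.addHaar_closedBall _ _ hr.le,
    finrank_euclideanSpace_fin, ENNReal.ofReal_mul (by positivity),
    ENNReal.ofReal_mul (by positivity), ENNReal.ofReal_toReal measure_ball_lt_top.ne,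
    mul_assoc, mul_comm (volume _)]
  gcongr
  rw [ENNReal.ofReal_pow (by positivity)]
  gcongr
  rw [← ENNReal.ofReal_coe_nnreal]
  simp

-- Compactness reduces the bound to finitely many graph charts, whose constants add up.
open Topology in
theorem exists_measure_frontier_le {d : ℕ} {D : Set (E d)} (hb : Bornology.IsBounded D)
    (hD : HasLipschitzBoundary D) :
    ∃ C : ℝ, 0 ≤ C ∧ ∀ (y : E d) (r : ℝ), 0 < r →
      (μHE[d - 1] : Measure (E d)) (frontier D ∩ Metric.closedBall y r) ≤
        ENNReal.ofReal (C * r ^ (d - 1)) := by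
  have hc : IsCompact (frontier D) := hb.isCompact_closure.of_isClosed_subset isClosed_frontier
    frontier_subset_closure
  refine hc.induction_on (p := fun s => ∃ C : ℝ, 0 ≤ C ∧ ∀ (y : E d) (r : ℝ), 0 < r →
      (μHE[d - 1] : Measure (E d)) (s ∩ Metric.closedBall y r) ≤
        ENNReal.ofReal (C * r ^ (d - 1))) ⟨0, le_rfl, by simp⟩ ?_ ?_ ?_
  · rintro s t hst ⟨C, hC, h⟩
    exact ⟨C, hC, fun y r hr => (measure_mono (inter_subset_inter_left _ hst)).trans (h y r hr)⟩
  · rintro s t ⟨C, hC, h⟩ ⟨C', hC', h'⟩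
    refine ⟨C + C', by positivity, fun y r hr => ?_⟩
    rw [union_inter_distrib_right, add_mul, ENNReal.ofReal_add (by positivity) (by positivity)]
    exact (measure_union_le _ _).trans (add_le_add (h y r hr) (h' y r hr))
  · intro x hx
    obtain ⟨r₀, hr₀, e, he, L, φ, hφ, hy⟩ := hD x hx
    obtain ⟨C, hC, h⟩ := exists_measure_graph_le he hφ
    refine ⟨frontier D ∩ Metric.ball x r₀,
      Filter.inter_mem self_mem_nhdsWithin (mem_nhdsWithin_of_mem_nhds (Metric.ball_mem_nhds x hr₀)),
      C, hC, fun y r hr => le_trans (measure_mono ?_) (h y r hr)⟩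
    rintro w ⟨⟨hwD, hwx⟩, hwy⟩
    refine ⟨?_, hwy⟩
    have hball : ∀ᶠ z in 𝓝 w, z ∈ Metric.ball x r₀ := Metric.isOpen_ball.mem_nhds hwx
    have hin : Continuous fun z : E d => inner ℝ e z := by fun_prop
    have hc1 : Continuous fun z : E d => φ (z - inner ℝ e z • e) :=
      hφ.continuous.comp (by fun_prop)
    -- Strict inequalities persist nearby and would put `w` in the interior of `D` or of its
    -- complement, so a frontier point lies on the graph.
    rcases lt_trichotomy (φ (w - inner ℝ e w • e)) (inner ℝ e w) with hlt | heq | hgt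
    · refine absurd ?_ hwD.2
      rw [mem_interior_iff_mem_nhds]
      filter_upwards [hball, hc1.continuousAt.eventually_lt hin.continuousAt hlt] with z hz hz'
      exact (hy z hz).2 hz'
    · exact heq
    · have : Dᶜ ∈ 𝓝 w := by
        filter_upwards [hball, hin.continuousAt.eventually_lt hc1.continuousAt hgt] with z hz hz' hzD
        exact lt_asymm ((hy z hz).1 hzD) hz'
      refine absurd hwD.1 ?_
      rw [← mem_compl_iff, ← interior_compl]
      exact mem_interior_iff_mem_nhds.2 this

/-! ### The parametric mesh -/

section Box

variable {d k : ℕ} (T : Fin d → OpenKnotVector k) (j : Fin d → ℕ)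

theorem box_eq_preimage :
    box T j = (fun x : E d => x.ofLp) ⁻¹'
      univ.pi fun l => Ioo ((T l).knot (j l)) ((T l).knot (j l + 1)) := by
  ext x
  rw [mem_preimage, mem_univ_pi]
  rfl

theorem isOpen_box : IsOpen (box T j) := by
  rw [box_eq_preimage]
  exact (isOpen_set_pi finite_univ fun _ _ => isOpen_Ioo).preimage (by fun_prop)

theorem box_subset_openCube : box T j ⊆ openCube d := by
  intro y hy l
  refine ⟨?_, ?_⟩
  · rw [← (T l).knot_left 0 (Nat.zero_le _)]
    exact ((T l).mono (Nat.zero_le _)).trans_lt (hy l).1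
  · rw [← (T l).knot_right (max (j l + 1) (T l).n) (le_max_right _ _)]
    exact (hy l).2.trans_le ((T l).mono (le_max_left _ _))

theorem convex_box : Convex ℝ (box T j) := by
  intro x hx y hy a b ha hb hab l
  exact convex_Ioo _ _ (hx l) (hy l) ha hb hab

theorem isBounded_closedCube (d : ℕ) : Bornology.IsBounded (closedCube d) := by
  refine Metric.isBounded_iff.2 ⟨√(∑ _ : Fin d, 1), fun x hx y hy => ?_⟩
  rw [EuclideanSpace.dist_eq]
  refine Real.sqrt_le_sqrt (Finset.sum_le_sum fun l _ => ?_)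
  have h1 := hx l
  have h2 := hy l
  rw [Real.dist_eq, sq_abs, sq_le_one_iff_abs_le_one, abs_le]
  constructor <;> linarith [h1.1, h1.2, h2.1, h2.2]

theorem openCube_subset_closedCube (d : ℕ) : openCube d ⊆ closedCube d :=
  fun _ hx l => Ioo_subset_Icc_self (hx l)

theorem box_subset_closedCube : box T j ⊆ closedCube d :=
  (box_subset_openCube T j).trans (openCube_subset_closedCube d)

theorem isBounded_box : Bornology.IsBounded (box T j) :=
  (isBounded_closedCube d).subset (box_subset_closedCube T j)

variable {T j}

theorem IsSpan.nonempty_box (hj : IsSpan T j) : (box T j).Nonempty :=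
  ⟨WithLp.toLp 2 fun l => ((T l).knot (j l) + (T l).knot (j l + 1)) / 2,
    fun l => ⟨left_lt_add_div_two.2 (hj l), add_div_two_lt_right.2 (hj l)⟩⟩

theorem IsSpan.edge_le_diam (hj : IsSpan T j) (l : Fin d) :
    (T l).knot (j l + 1) - (T l).knot (j l) ≤ Metric.diam (box T j) := by
  obtain ⟨x, hx⟩ := hj.nonempty_box
  have himage : Ioo ((T l).knot (j l)) ((T l).knot (j l + 1)) ⊆ (fun y : E d => y l) '' box T j := by
    intro t ht
    refine ⟨WithLp.toLp 2 (Function.update x.ofLp l t), fun l' => ?_, by simp⟩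
    rcases eq_or_ne l' l with rfl | h
    · simpa using ht
    · simpa [h] using hx l'
  have hlip : LipschitzWith 1 fun y : E d => y l :=
    LipschitzWith.of_dist_le_mul fun y z => by
      simpa [dist_eq_norm] using PiLp.norm_apply_le (y - z) l
  have hb := isBounded_box T j
  calc (T l).knot (j l + 1) - (T l).knot (j l)
      = Metric.diam (Ioo ((T l).knot (j l)) ((T l).knot (j l + 1))) := (Real.diam_Ioo (hj l).le).symm
    _ ≤ Metric.diam ((fun y : E d => y l) '' box T j) :=
        Metric.diam_mono himage (hlip.isBounded_image hb)
    _ ≤ Metric.diam (box T j) := by simpa using hlip.diam_image_le _ hb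

/-- The tensor structure makes all elements of the mesh comparable, however far apart. The mixed box
`m` shares edge `l` with box `i` and edge `l'` with box `j`; shape regularity of `m` and of `j`
costs one factor `σ` each. Two distinct directions are needed. -/
theorem ShapeRegular.sq_mul_diam_le (hd : 2 ≤ d) {σ : ℝ} (hσ : 0 < σ) (hT : ShapeRegular σ T)
    (hj : IsSpan T j) {i : Fin d → ℕ} (hi : IsSpan T i) (l : Fin d) :
    σ ^ 2 * Metric.diam (box T j) ≤ (T l).knot (i l + 1) - (T l).knot (i l) := by
  classical
  have : Nontrivial (Fin d) := Fin.nontrivial_iff_two_le.2 hd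
  obtain ⟨l', hl'⟩ := exists_ne l
  let m : Fin d → ℕ := Function.update i l' (j l')
  have hm : IsSpan T m := by
    intro a
    rcases eq_or_ne a l' with rfl | h
    · simpa [m] using hj a
    · simpa [m, h] using hi a
  have h1 := hT m hm l
  have h2 := hm.edge_le_diam l'
  have h3 := hT j hj l'
  simp only [m, Function.update_self, Function.update_of_ne hl'.symm] at h1 h2
  calc σ ^ 2 * Metric.diam (box T j) = σ * (σ * Metric.diam (box T j)) := by ring
    _ ≤ σ * Metric.diam (box T m) := by gcongr; exact h3.trans h2
    _ ≤ _ := h1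

theorem ShapeRegular.le_volume_box (hd : 2 ≤ d) {σ : ℝ} (hσ : 0 < σ) (hT : ShapeRegular σ T)
    (hj : IsSpan T j) {i : Fin d → ℕ} (hi : IsSpan T i) :
    ENNReal.ofReal ((σ ^ 2 * Metric.diam (box T j)) ^ d) ≤ volume (box T i) := by
  rw [box_eq_preimage T i, (PiLp.volume_preserving_ofLp (Fin d)).measure_preimage
    (MeasurableSet.univ_pi fun _ => measurableSet_Ioo).nullMeasurableSet, Real.volume_pi_Ioo,
    ENNReal.ofReal_pow (by positivity), ← Fin.prod_const]
  exact Finset.prod_le_prod' fun l _ => ENNReal.ofReal_le_ofReal (hT.sq_mul_diam_le hd hσ hj hi l)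

theorem IsSpan.diam_pos (hd : 2 ≤ d) (hj : IsSpan T j) : 0 < Metric.diam (box T j) :=
  (sub_pos.2 (hj ⟨0, by omega⟩)).trans_le (hj.edge_le_diam _)

end Box

/-! ### Bi-Lipschitz maps -/

/-- `F` is bi-Lipschitz on `S` with constant `L ≥ 1`. -/
structure IsBiLipschitzOn {d : ℕ} (L : NNReal) (F : E d → E d) (S : Set (E d)) : Prop where
  one_le : 1 ≤ L
  lipschitz : LipschitzOnWith L F S
  antilipschitz : ∀ x ∈ S, ∀ y ∈ S, dist x y ≤ L * dist (F x) (F y)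

namespace IsBiLipschitzOn

variable {d : ℕ} {L : NNReal} {F : E d → E d} {S S' : Set (E d)}

theorem mono (h : IsBiLipschitzOn L F S) (hS : S' ⊆ S) : IsBiLipschitzOn L F S' :=
  ⟨h.one_le, h.lipschitz.mono hS, fun x hx y hy => h.antilipschitz x (hS hx) y (hS hy)⟩

theorem injOn (h : IsBiLipschitzOn L F S) : InjOn F S := by
  intro x hx y hy hxy
  have := h.antilipschitz x hx y hy
  rw [hxy, dist_self, mul_zero] at this
  exact dist_le_zero.1 this

theorem lipschitzOnWith_invFunOn (h : IsBiLipschitzOn L F S) :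
    LipschitzOnWith L (Function.invFunOn F S) (F '' S) := by
  refine LipschitzOnWith.of_dist_le_mul ?_
  rintro _ ⟨x, hx, rfl⟩ _ ⟨y, hy, rfl⟩
  rw [h.injOn.leftInvOn_invFunOn hx, h.injOn.leftInvOn_invFunOn hy]
  exact h.antilipschitz x hx y hy

/-- Volume on `E d` is the normalized `d`-dimensional Hausdorff measure, so Lipschitz maps scale it
without any change of variables formula or measurability of `S`. -/
theorem volume_image_le (h : IsBiLipschitzOn L F S) :
    volume (F '' S) ≤ (L : ENNReal) ^ d * volume S := by
  rw [← EuclideanSpace.euclideanHausdorffMeasure_eq_volume]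
  exact euclideanHausdorffMeasure_image_le h.lipschitz d

theorem volume_le_image (h : IsBiLipschitzOn L F S) :
    volume S ≤ (L : ENNReal) ^ d * volume (F '' S) := by
  rw [← EuclideanSpace.euclideanHausdorffMeasure_eq_volume]
  have := euclideanHausdorffMeasure_image_le h.lipschitzOnWith_invFunOn d
  rwa [h.injOn.leftInvOn_invFunOn.image_image] at this

/-- Inside the open set `F '' S`, the image of `S'` is its preimage under the continuous inverse;
invariance of domain is not needed. -/
theorem isOpen_image (h : IsBiLipschitzOn L F S) (hS : IsOpen (F '' S)) (hS' : IsOpen S')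
    (hsub : S' ⊆ S) : IsOpen (F '' S') := by
  have := h.lipschitzOnWith_invFunOn.continuousOn.isOpen_inter_preimage hS hS'
  suffices hE : F '' S' = F '' S ∩ Function.invFunOn F S ⁻¹' S' by rwa [hE]
  ext y
  constructor
  · rintro ⟨x, hx, rfl⟩
    refine ⟨mem_image_of_mem F (hsub hx), ?_⟩
    rwa [mem_preimage, h.injOn.leftInvOn_invFunOn (hsub hx)]
  · rintro ⟨⟨x, hx, rfl⟩, hy⟩
    rw [mem_preimage, h.injOn.leftInvOn_invFunOn hx] at hy
    exact mem_image_of_mem F hy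

theorem diam_image_le (h : IsBiLipschitzOn L F S) (hb : Bornology.IsBounded S) :
    Metric.diam (F '' S) ≤ L * Metric.diam S := by
  refine Metric.diam_le_of_forall_dist_le (by positivity) ?_
  rintro _ ⟨x, hx, rfl⟩ _ ⟨y, hy, rfl⟩
  exact (h.lipschitz.dist_le_mul x hx y hy).trans
    (by gcongr; exact Metric.dist_le_diam_of_mem hb hx hy)

theorem isBounded_image (h : IsBiLipschitzOn L F S) (hb : Bornology.IsBounded S) :
    Bornology.IsBounded (F '' S) := by
  refine Metric.isBounded_iff.2 ⟨L * Metric.diam S, ?_⟩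
  rintro _ ⟨x, hx, rfl⟩ _ ⟨y, hy, rfl⟩
  exact (h.lipschitz.dist_le_mul x hx y hy).trans
    (by gcongr; exact Metric.dist_le_diam_of_mem hb hx hy)

end IsBiLipschitzOn

theorem IsParametrization.exists_isBiLipschitzOn {d : ℕ} {F : E d → E d}
    (hF : IsParametrization F) : ∃ L : NNReal, IsBiLipschitzOn L F (closedCube d) := by
  obtain ⟨L₁, h₁⟩ := hF.lipschitz
  obtain ⟨L₂, h₂⟩ := hF.antilipschitz
  refine ⟨max 1 (max L₁.toNNReal L₂.toNNReal), le_max_left _ _, ?_, fun x hx y hy => ?_⟩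
  · refine LipschitzOnWith.of_dist_le_mul fun x hx y hy => (h₁ x hx y hy).trans ?_
    gcongr
    exact (Real.le_coe_toNNReal L₁).trans
      (NNReal.coe_le_coe.2 ((le_max_left _ _).trans (le_max_right _ _)))
  · refine (h₂ x hx y hy).trans ?_
    gcongr
    exact (Real.le_coe_toNNReal L₂).trans
      (NNReal.coe_le_coe.2 ((le_max_right _ _).trans (le_max_right _ _)))

/-! ### Bounds on one element -/

/-- Removing a sublevel set that takes at most half of the guaranteed volume of `A` leaves the other
half. -/
theorem ofReal_le_measure_sup_level {d : ℕ} {δ ε r : ℝ} {P : MvPolynomial (Fin d) ℝ} {a x : E d}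
    (hr : 0 < r) (hδ : 0 < δ)
    (hP : volume {y ∈ Metric.closedBall a r | |polyFun P y| < ε * |polyFun P x|} ≤
      ENNReal.ofReal (δ * r ^ d)) {A : Set (E d)} (hA : A ⊆ Metric.closedBall a r)
    (hvol : ENNReal.ofReal (2 * δ * r ^ d) ≤ volume A) :
    ENNReal.ofReal (δ * r ^ d) ≤ volume {y ∈ A | ε * |polyFun P x| ≤ |polyFun P y|} := by
  have hsub : A ⊆ {y ∈ A | ε * |polyFun P x| ≤ |polyFun P y|} ∪
      {y ∈ Metric.closedBall a r | |polyFun P y| < ε * |polyFun P x|} := fun y hy =>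
    (le_or_gt (ε * |polyFun P x|) |polyFun P y|).imp (fun h => ⟨hy, h⟩) (fun h => ⟨hA hy, h⟩)
  have h1 := hvol.trans ((measure_mono hsub).trans ((measure_union_le _ _).trans
    (add_le_add_right hP _)))
  rw [show 2 * δ * r ^ d = δ * r ^ d + δ * r ^ d by ring,
    ENNReal.ofReal_add (by positivity) (by positivity)] at h1
  exact ENNReal.le_of_add_le_add_right ENNReal.ofReal_ne_top h1

theorem sq_mul_le_eLpNorm_sq {d : ℕ} {A : Set (E d)} {f : E d → ℝ}
    (hf : AEStronglyMeasurable f (volume.restrict A)) {t m : ℝ} (ht : 0 ≤ t)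
    (hm : ENNReal.ofReal m ≤ volume {y ∈ A | t ≤ |f y|}) :
    ENNReal.ofReal (t ^ 2 * m) ≤ eLpNorm f 2 (volume.restrict A) ^ 2 := by
  have h := mul_meas_ge_le_pow_eLpNorm' (μ := volume.restrict A) (p := 2) (by norm_num)
    (by norm_num) hf (ENNReal.ofReal t)
  have h2 : ENNReal.toReal 2 = ((2 : ℕ) : ℝ) := by norm_num
  rw [h2, ENNReal.rpow_natCast, ENNReal.rpow_natCast] at h
  rw [ENNReal.ofReal_mul (by positivity), ENNReal.ofReal_pow ht]
  refine le_trans ?_ h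
  gcongr
  refine hm.trans (le_trans (measure_mono ?_) (Measure.le_restrict_apply A _))
  intro y hy
  refine ⟨?_, hy.1⟩
  have : ENNReal.ofReal t ≤ ‖f y‖ₑ := by
    rw [Real.enorm_eq_ofReal_abs]
    exact ENNReal.ofReal_le_ofReal hy.2
  exact this

section Element

variable {d k : ℕ} {F : E d → E d} {L : NNReal}

theorem isOpen_image_box (hF : IsParametrization F) (T : Fin d → OpenKnotVector k)
    (j : Fin d → ℕ) : IsOpen (F '' box T j) := by
  obtain ⟨L, hL⟩ := hF.exists_isBiLipschitzOn
  exact (hL.mono (openCube_subset_closedCube d)).isOpen_image hF.isOpen_image (isOpen_box T j)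
    (box_subset_openCube T j)

theorem exists_polyFun_eq_on_image_box {T : Fin d → OpenKnotVector k} {q : E d → ℝ}
    (hq : q ∈ pressureSpace F T) (j : Fin d → ℕ) :
    ∃ P ∈ MvPolynomial.restrictDegree (Fin d) ℝ k, ∀ z ∈ box T j, q (F z) = polyFun P z := by
  obtain ⟨s, hs, hqs⟩ := hq
  obtain ⟨P, hP, hPs⟩ := exists_polyFun_eqOn_box T j hs
  exact ⟨P, hP, fun z hz => (hqs z (box_subset_openCube T j hz)).trans (hPs hz)⟩

theorem memLp_pressure (hF : IsParametrization F) {T : Fin d → OpenKnotVector k} {q : E d → ℝ}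
    (hq : q ∈ pressureSpace F T) (j : Fin d → ℕ) :
    MemLp q 2 (volume.restrict (F '' box T j)) := by
  obtain ⟨L, hL⟩ := hF.exists_isBiLipschitzOn
  have hLb := hL.mono (box_subset_closedCube T j)
  obtain ⟨P, -, hP⟩ := exists_polyFun_eq_on_image_box hq j
  have hbd := hLb.isBounded_image (isBounded_box T j)
  have hm := (isOpen_image_box hF T j).measurableSet
  have : IsFiniteMeasure (volume.restrict (F '' box T j)) :=
    ⟨by rw [Measure.restrict_apply_univ]; exact hbd.measure_lt_top⟩
  obtain ⟨C, hC⟩ := (isBounded_box T j).isCompact_closure.exists_bound_of_continuousOn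
    (continuous_polyFun P).continuousOn
  have hcont : ContinuousOn q (F '' box T j) := by
    refine ((continuous_polyFun P).comp_continuousOn
      hLb.lipschitzOnWith_invFunOn.continuousOn).congr ?_
    rintro _ ⟨z, hz, rfl⟩
    rw [Function.comp_apply, hLb.injOn.leftInvOn_invFunOn hz, hP z hz]
  refine MemLp.of_bound (hcont.aestronglyMeasurable hm) C ?_
  filter_upwards [ae_restrict_mem hm] with x hx
  obtain ⟨z, hz, rfl⟩ := hx
  rw [hP z hz]
  exact hC z (subset_closure hz)

/-- The sublevel estimate is applied to the polynomial `q ∘ F` on a ball containing `Q`, with `A = Q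
∩ F⁻¹(Ω)`; the large values found there are then carried to `K ∩ Ω` by `F`. -/
theorem exists_bound_on_good (hd : 2 ≤ d) (hF : IsParametrization F) (k : ℕ) (Ω : Set (E d))
    {θ : ℝ} (hθ : 0 < θ) {σ : ℝ} (hσ : 0 < σ) :
    ∃ C : ℝ, 0 < C ∧ ∀ T : Fin d → OpenKnotVector k, ShapeRegular σ T → ∀ j, IsSpan T j →
      θ ≤ volume.real (F '' box T j ∩ Ω) / volume.real (F '' box T j) →
      ∀ q ∈ pressureSpace F T, ∀ x ∈ F '' box T j,
        ENNReal.ofReal (q x ^ 2 * Metric.diam (F '' box T j) ^ d) ≤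
          ENNReal.ofReal C * eLpNorm q 2 (volume.restrict (F '' box T j ∩ Ω)) ^ 2 := by
  obtain ⟨L, hL⟩ := hF.exists_isBiLipschitzOn
  have hL0 : (0 : ℝ) < L := zero_lt_one.trans_le (by exact_mod_cast hL.one_le)
  -- Chosen so that `2 δ ρ^d` bounds `|A|` from below: one `L^d` is lost from `Q` to `K`, then `θ`
  -- from `K` to `K ∩ Ω`, then another `L^d` on the way back to `A`.
  set δ : ℝ := θ * (σ ^ 2) ^ d / (L ^ d) ^ 2 / 2 with hδ
  have hδ0 : 0 < δ := by positivity
  obtain ⟨ε, hε, hR⟩ := exists_sublevel_ball d k hδ0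
  refine ⟨(L ^ d) ^ 2 / (ε ^ 2 * δ), by positivity, ?_⟩
  rintro T hT j hj hgood q hq _ ⟨z, hz, rfl⟩
  set Q := box T j with hQ
  set K := F '' Q with hK
  have hLQ : IsBiLipschitzOn L F Q := hL.mono (box_subset_closedCube T j)
  set ρ := Metric.diam Q with hρ
  have hρ0 : 0 < ρ := hj.diam_pos hd
  obtain ⟨P, hPk, hP⟩ := exists_polyFun_eq_on_image_box hq j
  have hQball : Q ⊆ Metric.closedBall z ρ := fun y hy =>
    Metric.dist_le_diam_of_mem (isBounded_box T j) hy hz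
  have hKfin : volume K ≠ ⊤ := (hLQ.isBounded_image (isBounded_box T j)).measure_lt_top.ne
  have hvolQ := hT.le_volume_box hd hσ hj hj
  have hLd : (L : ENNReal) ^ d = ENNReal.ofReal ((L : ℝ) ^ d) := by
    rw [ENNReal.ofReal_pow L.coe_nonneg, ENNReal.ofReal_coe_nnreal]
  set A := Q ∩ F ⁻¹' Ω with hA
  have hFA : F '' A = K ∩ Ω := image_inter_preimage F Q Ω
  have hvolA : ENNReal.ofReal (2 * δ * ρ ^ d) ≤ volume A := by
    have h1 : ENNReal.ofReal ((σ ^ 2 * ρ) ^ d) ≤ ENNReal.ofReal (L ^ d) * volume K := by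
      rw [← hLd]; exact hvolQ.trans hLQ.volume_le_image
    have hKreal : 0 < volume.real K := by
      refine ENNReal.toReal_pos (fun h0 => ?_) hKfin
      rw [h0, mul_zero, nonpos_iff_eq_zero, ENNReal.ofReal_eq_zero] at h1
      exact absurd h1 (not_le.2 (by positivity))
    have h2 : ENNReal.ofReal θ * volume K ≤ volume (K ∩ Ω) := by
      rw [le_div_iff₀ hKreal] at hgood
      rw [← ENNReal.ofReal_toReal hKfin, ← ENNReal.ofReal_mul hθ.le,
        ← ENNReal.ofReal_toReal (measure_ne_top_of_subset inter_subset_left hKfin)]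
      exact ENNReal.ofReal_le_ofReal hgood
    have h3 : volume (K ∩ Ω) ≤ ENNReal.ofReal (L ^ d) * volume A := by
      rw [← hFA, ← hLd]
      exact (hLQ.mono inter_subset_left).volume_image_le
    have h4 : ENNReal.ofReal ((L ^ d) ^ 2) * ENNReal.ofReal (2 * δ * ρ ^ d) ≤
        ENNReal.ofReal ((L ^ d) ^ 2) * volume A := by
      calc ENNReal.ofReal ((L ^ d) ^ 2) * ENNReal.ofReal (2 * δ * ρ ^ d)
          = ENNReal.ofReal θ * ENNReal.ofReal ((σ ^ 2 * ρ) ^ d) := by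
            rw [← ENNReal.ofReal_mul (by positivity), ← ENNReal.ofReal_mul hθ.le]
            congr 1
            rw [hδ, mul_pow (σ ^ 2)]
            field_simp
        _ ≤ ENNReal.ofReal θ * (ENNReal.ofReal (L ^ d) * volume K) := by gcongr
        _ = ENNReal.ofReal (L ^ d) * (ENNReal.ofReal θ * volume K) := mul_left_comm _ _ _
        _ ≤ ENNReal.ofReal (L ^ d) * (ENNReal.ofReal (L ^ d) * volume A) := by
            exact mul_le_mul' le_rfl (h2.trans h3)
        _ = ENNReal.ofReal ((L ^ d) ^ 2) * volume A := by
            rw [← mul_assoc, ← ENNReal.ofReal_mul (by positivity), sq]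
    refine (ENNReal.mul_le_mul_iff_right ?_ ENNReal.ofReal_ne_top).1 h4
    rw [Ne, ENNReal.ofReal_eq_zero, not_le]
    positivity
  have h5 := ofReal_le_measure_sup_level hρ0 hδ0
    (hR P hPk z ρ hρ0 z (Metric.mem_closedBall_self hρ0.le)) (inter_subset_left.trans hQball) hvolA
  set B := {y ∈ A | ε * |polyFun P z| ≤ |polyFun P y|} with hB
  have hBA : B ⊆ A := fun y hy => hy.1
  have h6 : ENNReal.ofReal (δ * ρ ^ d / L ^ d) ≤
      volume {y ∈ K ∩ Ω | ε * |q (F z)| ≤ |q y|} := by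
    have h7 : ENNReal.ofReal (δ * ρ ^ d) ≤ ENNReal.ofReal (L ^ d) * volume (F '' B) := by
      rw [← hLd]
      exact h5.trans (hLQ.mono (hBA.trans inter_subset_left)).volume_le_image
    have h8 : ENNReal.ofReal (δ * ρ ^ d / L ^ d) ≤ volume (F '' B) := by
      rw [ENNReal.ofReal_div_of_pos (by positivity)]
      exact ENNReal.div_le_of_le_mul' h7
    refine h8.trans (measure_mono ?_)
    rintro _ ⟨y, hy, rfl⟩
    refine ⟨⟨mem_image_of_mem F hy.1.1, hy.1.2⟩, ?_⟩
    rw [hP z hz, hP y hy.1.1]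
    exact hy.2
  have hqm : AEStronglyMeasurable q (volume.restrict (K ∩ Ω)) :=
    (memLp_pressure hF hq j).1.mono_measure (Measure.restrict_mono inter_subset_left le_rfl)
  have h9 := sq_mul_le_eLpNorm_sq hqm (by positivity) h6
  have hdiam : Metric.diam K ≤ L * ρ := hLQ.diam_image_le (isBounded_box T j)
  calc ENNReal.ofReal (q (F z) ^ 2 * Metric.diam K ^ d)
      ≤ ENNReal.ofReal ((L ^ d) ^ 2 / (ε ^ 2 * δ) *
          ((ε * |q (F z)|) ^ 2 * (δ * ρ ^ d / L ^ d))) := by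
        refine ENNReal.ofReal_le_ofReal ?_
        calc q (F z) ^ 2 * Metric.diam K ^ d ≤ q (F z) ^ 2 * (L * ρ) ^ d := by
              gcongr
          _ = _ := by
            rw [mul_pow, mul_pow, sq_abs]
            field_simp
    _ = ENNReal.ofReal ((L ^ d) ^ 2 / (ε ^ 2 * δ)) *
          ENNReal.ofReal ((ε * |q (F z)|) ^ 2 * (δ * ρ ^ d / L ^ d)) :=
        ENNReal.ofReal_mul (by positivity)
    _ ≤ _ := by gcongr

/-- The projection is a polynomial in physical coordinates, so the sublevel estimate is used there,
on a ball about `x ∈ K` that contains `K'` and of which `K'` fills a fixed fraction. -/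
theorem exists_bound_on_bad (hd : 2 ≤ d) (hF : IsParametrization F) (k : ℕ)
    {σ : ℝ} (hσ : 0 < σ) {c : ℝ} (hc : 0 < c) :
    ∃ C : ℝ, 0 < C ∧ ∀ T : Fin d → OpenKnotVector k, ShapeRegular σ T →
      ∀ j, IsSpan T j → ∀ i, IsSpan T i →
      setDist (F '' box T j) (F '' box T i) ≤ c * Metric.diam (F '' box T j) →
      ∀ q ∈ pressureSpace F T, ∀ x ∈ F '' box T j,
        ENNReal.ofReal (polyFun (l2Proj k (F '' box T i) q) x ^ 2 *
            Metric.diam (F '' box T j) ^ d) ≤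
          ENNReal.ofReal C * eLpNorm q 2 (volume.restrict (F '' box T i)) ^ 2 := by
  obtain ⟨L, hL⟩ := hF.exists_isBiLipschitzOn
  have hL1 : (1 : ℝ) ≤ L := by exact_mod_cast hL.one_le
  have hL0 : (0 : ℝ) < L := zero_lt_one.trans_le hL1
  -- In units of `ρ`: `L / σ²` bounds the diameter of `K'`, `c L` the distance between the elements
  -- and `L` the diameter of `K`. The remaining `L` is slack, as the infimum in `setDist` need not
  -- be attained.
  set R : ℝ := L / σ ^ 2 + (c + 2) * L with hR
  have hR0 : 0 < R := by positivity
  -- Makes `2 δ (R ρ)^d` equal to the lower bound `(σ² ρ)^d / L^d` for the volume of `K'`.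
  set δ : ℝ := (σ ^ 2 / R) ^ d / L ^ d / 2 with hδ
  have hδ0 : 0 < δ := by positivity
  obtain ⟨ε, hε, hsub⟩ := exists_sublevel_ball d k hδ0
  refine ⟨L ^ d / R ^ d / (ε ^ 2 * δ), by positivity, ?_⟩
  rintro T hT j hj i hi hdist q hq x hx
  have hLj : IsBiLipschitzOn L F (box T j) := hL.mono (box_subset_closedCube T j)
  have hLi : IsBiLipschitzOn L F (box T i) := hL.mono (box_subset_closedCube T i)
  set K := F '' box T j with hK
  set K' := F '' box T i with hK'
  set ρ := Metric.diam (box T j) with hρ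
  have hρ0 : 0 < ρ := hj.diam_pos hd
  have hρi : Metric.diam (box T i) ≤ ρ / σ ^ 2 := by
    rw [le_div_iff₀' (by positivity)]
    exact (hT.sq_mul_diam_le hd hσ hi hj ⟨0, by omega⟩).trans (hj.edge_le_diam _)
  have hKb : Bornology.IsBounded K := hLj.isBounded_image (isBounded_box T j)
  have hKb' : Bornology.IsBounded K' := hLi.isBounded_image (isBounded_box T i)
  have hdiam : Metric.diam K ≤ L * ρ := hLj.diam_image_le (isBounded_box T j)
  have hdiam' : Metric.diam K' ≤ L * (ρ / σ ^ 2) :=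
    (hLi.diam_image_le (isBounded_box T i)).trans (by gcongr)
  have hKne : K.Nonempty := hj.nonempty_box.image F
  have hKne' : K'.Nonempty := hi.nonempty_box.image F
  have hball : K' ⊆ Metric.closedBall x (R * ρ) := by
    have : Nonempty (K × K') := ⟨⟨_, hKne.some_mem⟩, ⟨_, hKne'.some_mem⟩⟩
    have hlt : (⨅ p : K × K', dist (p.1 : E d) (p.2 : E d)) < c * (L * ρ) + L * ρ := by
      have h1 : setDist K K' < c * (L * ρ) + L * ρ := by
        have : c * Metric.diam K ≤ c * (L * ρ) := by gcongr
        have : 0 < L * ρ := by positivity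
        linarith
      exact h1
    obtain ⟨⟨⟨a, ha⟩, ⟨b, hb⟩⟩, hab⟩ := exists_lt_of_ciInf_lt hlt
    intro y hy
    rw [Metric.mem_closedBall]
    have h1 : dist y b ≤ L * (ρ / σ ^ 2) :=
      (Metric.dist_le_diam_of_mem hKb' hy hb).trans hdiam'
    have h2 : dist a x ≤ L * ρ := (Metric.dist_le_diam_of_mem hKb ha hx).trans hdiam
    have h3 : dist b a < c * (L * ρ) + L * ρ := by rw [dist_comm]; exact hab
    have h4 : dist y x ≤ dist y b + dist b a + dist a x := dist_triangle4 _ _ _ _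
    have h5 : R * ρ = L * (ρ / σ ^ 2) + (c * (L * ρ) + L * ρ) + L * ρ := by
      rw [hR]; ring
    linarith
  have hvol : ENNReal.ofReal (2 * δ * (R * ρ) ^ d) ≤ volume K' := by
    have h1 := (hT.le_volume_box hd hσ hj hi).trans hLi.volume_le_image
    have h2 : 2 * δ * (R * ρ) ^ d = (σ ^ 2 * ρ) ^ d / L ^ d := by
      rw [hδ, mul_pow, mul_pow, div_pow]
      field_simp
    rw [h2, ENNReal.ofReal_div_of_pos (by positivity), ENNReal.ofReal_pow hL0.le,
      ENNReal.ofReal_coe_nnreal]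
    exact ENNReal.div_le_of_le_mul' h1
  have hqm := memLp_pressure hF hq i
  have hproj := isL2Proj_l2Proj k (isOpen_image_box hF T i) hKne' hKb' hqm
  set P := l2Proj k K' q with hP
  have h5 := ofReal_le_measure_sup_level (by positivity) hδ0
    (hsub P hproj.1 x (R * ρ) (by positivity) x (Metric.mem_closedBall_self (by positivity)))
    hball hvol
  have h6 := sq_mul_le_eLpNorm_sq (continuous_polyFun P).aestronglyMeasurable
    (by positivity) h5
  calc ENNReal.ofReal (polyFun P x ^ 2 * Metric.diam K ^ d)
      ≤ ENNReal.ofReal (L ^ d / R ^ d / (ε ^ 2 * δ) *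
          ((ε * |polyFun P x|) ^ 2 * (δ * (R * ρ) ^ d))) := by
        refine ENNReal.ofReal_le_ofReal ?_
        calc polyFun P x ^ 2 * Metric.diam K ^ d ≤ polyFun P x ^ 2 * (L * ρ) ^ d := by
              gcongr
          _ = _ := by
            rw [mul_pow, mul_pow, mul_pow, sq_abs]
            field_simp
    _ = ENNReal.ofReal (L ^ d / R ^ d / (ε ^ 2 * δ)) *
          ENNReal.ofReal ((ε * |polyFun P x|) ^ 2 * (δ * (R * ρ) ^ d)) :=
        ENNReal.ofReal_mul (by positivity)
    _ ≤ _ := by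
        gcongr
        exact h6.trans (by gcongr; exact hproj.eLpNorm_le hKb' hqm)

end Element

/-! ### The stabilization operator -/

/-- Since `K` is open and meets the closure of an uncut element, it meets that element; disjointness
of the mesh makes them equal. So the connected set `K` misses `Γ` and, as it meets `Ω`, lies in it.
-/
theorem subset_of_subset_interiorRegion {d k : ℕ} {F : E d → E d} (hF : IsParametrization F)
    {Ω : Set (E d)} {T : Fin d → OpenKnotVector k} {K : Set (E d)}
    (hK : K ∈ activeMesh F Ω T) (hsub : K ⊆ interiorRegion (activeMesh F Ω T) Ω) : K ⊆ Ω := by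
  obtain ⟨L, hL⟩ := hF.exists_isBiLipschitzOn
  obtain ⟨_, ⟨j, _, rfl⟩, ⟨z, hz, _, hzΩ⟩, hKeq⟩ := id hK
  have hopen : IsOpen K := hKeq ▸ isOpen_image_box hF T j
  have hzK : F z ∈ K := hKeq ▸ mem_image_of_mem F hz
  have hpre : IsPreconnected K := by
    rw [hKeq]
    exact (convex_box T j).isPreconnected.image F
      (hL.lipschitz.continuousOn.mono (box_subset_closedCube T j))
  obtain ⟨K₁, hK₁, hzK₁⟩ := mem_iUnion₂.1 (hsub hzK)
  obtain ⟨y, hyK, hyK₁⟩ := mem_closure_iff.1 hzK₁ K hopen hzK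
  have hKK₁ : K = K₁ := (cellAt_eq hF hK hyK).symm.trans (cellAt_eq hF hK₁.1 hyK₁)
  have hfr : ∀ v ∈ K, v ∉ frontier Ω := fun v hvK hv => hK₁.2 ⟨hK₁.1, v, hv, hKK₁ ▸ hvK⟩
  have hin : ∀ v ∈ K, v ∈ Ω → v ∈ interior Ω := fun v hvK hv =>
    by_contra fun h => hfr v hvK ⟨subset_closure hv, h⟩
  have hout : ∀ v ∈ K, v ∉ Ω → v ∈ interior Ωᶜ := fun v hvK hv => by
    rw [interior_compl]
    exact fun h => hfr v hvK ⟨h, fun hi => hv (interior_subset hi)⟩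
  by_contra hnot
  obtain ⟨w, hwK, hwΩ⟩ := not_subset.1 hnot
  obtain ⟨v, -, hv, hv'⟩ := hpre _ _ isOpen_interior isOpen_interior
    (fun v hv => (em (v ∈ Ω)).imp (hin v hv) (hout v hv)) ⟨_, hzK, hin _ hzK hzΩ⟩
    ⟨w, hwK, hout w hwK hwΩ⟩
  exact interior_subset hv' (interior_subset hv)

theorem eLpNorm_sq_le_of_forall_sq_le {α : Type*} [MeasurableSpace α] {μ : Measure α} {s : Set α}
    (hs : MeasurableSet s) {f : α → ℝ} {B : ENNReal} {m : ℝ}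
    (hf : ∀ x ∈ s, ENNReal.ofReal (f x ^ 2 * m) ≤ B) (hm : μ s ≤ ENNReal.ofReal m) :
    eLpNorm f 2 (μ.restrict s) ^ 2 ≤ B := by
  have hnorm : eLpNorm f 2 (μ.restrict s) ^ 2 = ∫⁻ x in s, ‖f x‖ₑ ^ 2 ∂μ := by
    have := eLpNorm_nnreal_pow_eq_lintegral (f := f) (μ := μ.restrict s) (p := 2) (by norm_num)
    simpa using this
  rw [hnorm]
  rcases le_or_gt m 0 with hm0 | hm0
  · have h0 : μ s = 0 := by
      rwa [ENNReal.ofReal_of_nonpos hm0, nonpos_iff_eq_zero] at hm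
    rw [setLIntegral_measure_zero _ _ h0]
    exact zero_le
  · have hm1 : ENNReal.ofReal m ≠ 0 := by simpa using hm0
    calc ∫⁻ x in s, ‖f x‖ₑ ^ 2 ∂μ ≤ ∫⁻ _ in s, B / ENNReal.ofReal m ∂μ := by
          refine setLIntegral_mono' hs fun x hx => ?_
          rw [ENNReal.le_div_iff_mul_le (Or.inl hm1) (Or.inl ENNReal.ofReal_ne_top),
            Real.enorm_eq_ofReal_abs, ← ENNReal.ofReal_pow (abs_nonneg _), sq_abs,
            ← ENNReal.ofReal_mul (sq_nonneg _)]
          exact hf x hx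
      _ = B / ENNReal.ofReal m * μ s := by rw [setLIntegral_const]
      _ ≤ B / ENNReal.ofReal m * ENNReal.ofReal m := by gcongr
      _ = B := ENNReal.div_mul_cancel hm1 ENNReal.ofReal_ne_top

theorem le_sqrt_mul_of_sq_le {a b : ENNReal} {C : ℝ} (hC : 0 ≤ C)
    (h : a ^ 2 ≤ ENNReal.ofReal C * b ^ 2) : a ≤ ENNReal.ofReal √C * b := by
  refine (ENNReal.pow_right_strictMono two_ne_zero).le_iff_le.1 ?_
  rwa [mul_pow, ← ENNReal.ofReal_pow (Real.sqrt_nonneg C), Real.sq_sqrt hC]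

/-- The pointwise bound of the stabilized function on an element. -/
theorem exists_bound_localStab {d k : ℕ} (hd : 2 ≤ d) {F : E d → E d} (hF : IsParametrization F)
    (Ω : Set (E d)) {θ : ℝ} (hθ : 0 < θ) {σ : ℝ} (hσ : 0 < σ) {c : ℝ} (hc : 0 < c) :
    ∃ C : ℝ, 0 < C ∧ ∀ T : Fin d → OpenKnotVector k, ShapeRegular σ T →
      ∀ nb : Set (E d) → Set (E d),
        (∀ K ∈ badElements (activeMesh F Ω T) Ω θ,
          IsGoodNeighbor (activeMesh F Ω T) Ω θ c K (nb K)) →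
      ∀ K ∈ activeMesh F Ω T, ∀ q ∈ pressureSpace F T, ∀ x ∈ K,
        ENNReal.ofReal (localStab k (activeMesh F Ω T) Ω θ nb K q x ^ 2 * Metric.diam K ^ d) ≤
          ENNReal.ofReal C * eLpNorm q 2
            (volume.restrict (attached (activeMesh F Ω T) Ω θ nb K ∩ Ω)) ^ 2 := by
  obtain ⟨C₁, hC₁, h₁⟩ := exists_bound_on_good hd hF k Ω hθ hσ
  obtain ⟨C₂, hC₂, h₂⟩ := exists_bound_on_bad hd hF k hσ hc
  refine ⟨max C₁ C₂, lt_max_of_lt_left hC₁, fun T hT nb hnb K hK q hq x hx => ?_⟩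
  by_cases hbad : K ∈ badElements (activeMesh F Ω T) Ω θ
  · rw [localStab, if_pos hbad, attached, if_pos hbad]
    obtain ⟨⟨⟨⟨hnbM, hdist⟩, -⟩, -⟩, hsub⟩ := hnb K hbad
    -- The projection uses `q` on all of `K'`, while the target norm only sees `K' ∩ Ω`; here the
    -- two sets coincide.
    rw [inter_eq_self_of_subset_left (subset_of_subset_interiorRegion hF hnbM hsub)]
    obtain ⟨_, ⟨j, hj, rfl⟩, -, rfl⟩ := hK
    obtain ⟨_, ⟨i, hi, rfl⟩, -, hnbK⟩ := hnbM
    rw [hnbK] at hdist ⊢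
    refine (h₂ T hT j hj i hi hdist q hq x hx).trans ?_
    gcongr
    exact le_max_right _ _
  · rw [localStab, if_neg hbad, attached, if_neg hbad]
    have hgood : K ∈ goodElements (activeMesh F Ω T) Ω θ := by
      by_contra h
      exact hbad ⟨hK, h⟩
    obtain ⟨_, ⟨j, hj, rfl⟩, -, rfl⟩ := hK
    refine (h₁ T hT j hj hgood.2 q hq x hx).trans ?_
    gcongr
    exact le_max_left _ _

end TrimmedIGA

/-! ### The trace and volume estimates -/

theorem mainTheorem8 (d : ℕ) (hd : d = 2 ∨ d = 3) (k : ℕ) (hk : 1 ≤ k)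
    (F : E d → E d) (hF : IsParametrization F)
    (Ω₁ Ω : Set (E d)) (hΩ : Ω = trimmedDomain F Ω₁) (hLip : HasLipschitzBoundary Ω)
    (θ : ℝ) (hθ₀ : 0 < θ) (hθ₁ : θ ≤ 1) (σ : ℝ) (hσ : 0 < σ) (c : ℝ) (hc : 0 < c) :
    ∃ C₁ > (0 : ℝ), ∃ C₂ > (0 : ℝ),
      ∀ T : Fin d → OpenKnotVector k, ShapeRegular σ T → SmoothOnElements F T →
      ∀ M : Set (Set (E d)), M = activeMesh F Ω T →
      ∀ nb : Set (E d) → Set (E d),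
        (∀ K ∈ badElements M Ω θ, IsGoodNeighbor M Ω θ c K (nb K)) →
      ∀ K ∈ M, ∀ q ∈ pressureSpace F T,
        eLpNorm (fun x => Real.sqrt (meshSize M x) * stab k M Ω θ nb q x) 2
            ((μHE[d - 1] : Measure (E d)).restrict (boundaryPart Ω K)) ≤
          ENNReal.ofReal C₁ *
            eLpNorm q 2 (volume.restrict (attached M Ω θ nb K ∩ Ω)) ∧
        eLpNorm (stab k M Ω θ nb q) 2 (volume.restrict (K ∩ Ω)) ≤
          ENNReal.ofReal C₂ *
            eLpNorm q 2 (volume.restrict (attached M Ω θ nb K ∩ Ω)) := by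
  have hd2 : 2 ≤ d := by omega
  obtain ⟨L, hL⟩ := hF.exists_isBiLipschitzOn
  have hLo := hL.mono (openCube_subset_closedCube d)
  have hΩo : IsOpen Ω := by
    rw [hΩ]
    exact hF.isOpen_image.sdiff isClosed_closure
  have hΩb : Bornology.IsBounded Ω := by
    rw [hΩ]
    exact (hLo.isBounded_image ((isBounded_closedCube d).subset
      (openCube_subset_closedCube d))).subset sdiff_subset
  obtain ⟨A, hA, hγ⟩ := exists_measure_frontier_le hΩb hLip
  obtain ⟨C, hC, hstab⟩ := exists_bound_localStab (k := k) hd2 hF Ω hθ₀ hσ hc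
  set V := (volume (Metric.ball (0 : E d) 1)).toReal with hV
  have hV0 : 0 ≤ V := ENNReal.toReal_nonneg
  -- Only nonnegativity of `A` and `V` is available; adding `1` makes the constants positive.
  refine ⟨√((A + 1) * C), by positivity, √((V + 1) * C), by positivity, ?_⟩
  rintro T hT - _ rfl nb hnb K hK q hq
  have hbound := hstab T hT nb hnb K hK q hq
  have hKo : IsOpen K := by
    obtain ⟨_, ⟨j, _, rfl⟩, -, rfl⟩ := hK
    exact isOpen_image_box hF T j
  obtain ⟨y, hy, hball, hh⟩ :
      ∃ y ∈ K, K ⊆ Metric.closedBall y (Metric.diam K) ∧ 0 < Metric.diam K := by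
    obtain ⟨_, ⟨j, hj, rfl⟩, -, rfl⟩ := hK
    have hLj := hL.mono (box_subset_closedCube T j)
    have hb := hLj.isBounded_image (isBounded_box T j)
    obtain ⟨z, hz⟩ := hj.nonempty_box
    refine ⟨F z, mem_image_of_mem F hz,
      fun w hw => Metric.dist_le_diam_of_mem hb hw (mem_image_of_mem F hz), ?_⟩
    refine Metric.diam_pos ?_ hb
    have hnt : (box T j).Nontrivial := by
      by_contra h
      exact (hj.diam_pos hd2).ne' (Metric.diam_subsingleton (not_nontrivial_iff.1 h))
    exact hnt.image_of_injOn hLj.injOn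
  set h := Metric.diam K
  have hcell : ∀ x ∈ K, cellAt (activeMesh F Ω T) x = K := fun x hx => cellAt_eq hF hK hx
  constructor
  · refine le_sqrt_mul_of_sq_le (by positivity) (eLpNorm_sq_le_of_forall_sq_le
      (m := (A + 1) * h ^ (d - 1)) (isClosed_frontier.measurableSet.inter hKo.measurableSet)
      (fun x hx => ?_) ?_)
    · rw [stab, meshSize, hcell x hx.2, mul_pow, Real.sq_sqrt hh.le,
        ENNReal.ofReal_mul (p := A + 1) (by positivity), mul_assoc (ENNReal.ofReal (A + 1))]
      refine le_trans (le_of_eq ?_) (mul_le_mul' le_rfl (hbound x hx.2))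
      rw [← ENNReal.ofReal_mul (by positivity)]
      congr 1
      -- The squared weight contributes `h`, which completes `h^(d-1)` to the `h^d` of the pointwise
      -- bound; `d ≥ 1` keeps the natural subtraction honest.
      obtain ⟨n, rfl⟩ : ∃ n, d = n + 1 := ⟨d - 1, by omega⟩
      rw [Nat.add_sub_cancel, pow_succ h n]
      ring
    · refine (measure_mono (inter_subset_inter_right _ hball)).trans ((hγ y h hh).trans ?_)
      exact ENNReal.ofReal_le_ofReal (by gcongr; linarith)
  · refine le_sqrt_mul_of_sq_le (by positivity) (eLpNorm_sq_le_of_forall_sq_le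
      (m := (V + 1) * h ^ d) (hKo.inter hΩo).measurableSet (fun x hx => ?_) ?_)
    · rw [stab, hcell x hx.1, ENNReal.ofReal_mul (p := V + 1) (by positivity),
        mul_assoc (ENNReal.ofReal (V + 1))]
      refine le_trans (le_of_eq ?_) (mul_le_mul' le_rfl (hbound x hx.1))
      rw [← ENNReal.ofReal_mul (by positivity)]
      congr 1
      ring
    · refine (measure_mono (inter_subset_left.trans hball)).trans ?_
      rw [Measure.addHaar_closedBall _ _ hh.le, finrank_euclideanSpace_fin,
        ← ENNReal.ofReal_toReal (measure_ball_lt_top (μ := volume) (x := (0 : E d)) (r := 1)).ne,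
        ← ENNReal.ofReal_mul (by positivity), ← hV]
      refine ENNReal.ofReal_le_ofReal ?_
      rw [mul_comm]
      gcongr
      linarith
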